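/- Let $M$ be a smooth manifold of dimension $4n$, $n\ge 2$, with a Riemannian metric $g$ and a rank-three subbundle $\mathcal G\subset\operatorname{End}TM$ that locally has adapted bases, i.e. smooth local bases $I,J,K$ of $\mathcal G$ by $g$-orthogonal endomorphisms with $I^2=J^2=-1$ and $K=IJ=-JI$ (an almost quaternion-Hermitian manifold). Let $\nabla$ be the Levi-Civita connection, let $U\subset M$ be an open set on which an adapted basis $I,J,K$ is defined, and put on $U$ $$\omega_A(X,Y)=g(X,AY)\ \ (A=I,J,K),\qquad \Omega=\omega_I\wedge\omega_I+\omega_J\wedge\omega_J+\omega_K\wedge\omega_K .$$ For a $(0,s)$-tensor $b$ write $A_{(i)}b(X_1,\dots,X_s)=-b(X_1,\dots,AX_i,\dots,X_s)$; the first slot of $\nabla b$ is the direction of differentiation. Put $$\lambda_I(X)=\tfrac1{4n}\langle\nabla_X\omega_J,\omega_K\rangle,\qquad \alpha_I=-\lambda_I\otimes g+\tfrac12\,(J_{(2)}-J_{(3)})\nabla\omega_K,$$ where $\langle a,b\rangle=\sum_{i,j}a(e_i,e_j)b(e_i,e_j)$ for an orthonormal basis $(e_i)$, and define $\alpha_J,\alpha_K$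 by cyclic permutation of $I,J,K$. Let $Sp(1)$, the group of unit quaternions, act on tangent vectors through $i\mapsto I$, $j\mapsto J$, $k\mapsto K$, and hence on tensors; let $H=\mathbb C^2\cong\mathbb H$ be its standard complex representation, and let $(\nabla\Omega)_H$ and $(\nabla\Omega)_{S^3H}$ be the components of $\nabla\Omega$ in the isotypic subspaces of the $(0,5)$-tensors of type $H$ and $S^3H$. Then at every point of $U$: (i) $(\nabla\Omega)_H$ is linearly determined by $I_{(1)}\alpha_I+J_{(1)}\alpha_J+K_{(1)}\alpha_K$; (ii) $(\nabla\Omega)_{S^3H}$ is linearly determined by the pair $\bigl(I_{(1)}\alpha_I-J_{(1)}\alpha_J,\ J_{(1)}\alpha_J-K_{(1)}\alpha_K\bigr)$. Here "$b$ is linearly determined by $a$" means the following. Let $(V,g_0,I_0,J_0,K_0)$ be a real inner product space of dimension $4n$ with orthogonal endomorphisms satisfying $I_0^2=J_0^2=-1$, $K_0=I_0J_0=-J_0I_0$. Then there are linear maps $L$, $L'$ between the relevant tensor spaces of $V$, depending on $(V,g_0,I_0,J_0,K_0)$ only (and not on $M$, $g$, $\mathcal G$, $U$, $I,J,K$ or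 the point), such that $f^*b_x=L(f^*a_x)$ and, conversely, $f^*a_x=L'(f^*b_x)$ for all $M,g,\mathcal G,U,I,J,K$ as above, all $x\in U$ and all linear isometries $f:V\to T_xM$ carrying $I_0,J_0,K_0$ to $I_x,J_x,K_x$. In particular $b_x=0$ if and only if $a_x=0$. -/

import Mathlib

open scoped Manifold ContDiff Bundle Quaternion

noncomputable section

namespace AQH

/-! ### Tensors on a real vector space -/

section Algebra

variable {V : Type*} [AddCommGroup V] [Module ℝ V]

/-- `(0,s)`-tensors on a real vector space `V`. The slots are numbered `0, …, s - 1`. -/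
abbrev Tens (V : Type*) [AddCommGroup V] [Module ℝ V] (s : ℕ) : Type _ :=
  MultilinearMap ℝ (fun _ : Fin s => V) ℝ

/-- `A_(i) b (X_1,…,X_s) = - b (X_1,…,A X_i,…,X_s)`. -/
def slotAct {s : ℕ} (A : V →ₗ[ℝ] V) (i : Fin s) (b : Tens V s) : Tens V s :=
  -b.compLinearMap (Function.update (fun _ => LinearMap.id) i A)

/-- The derivation `∑ i, A_(i)`. It is the infinitesimal action of `A` on `(0,s)`-tensors. -/
def derAct {s : ℕ} (A : V →ₗ[ℝ] V) (b : Tens V s) : Tens V s :=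
  ∑ i : Fin s, slotAct A i b

/-- The pull-back of a `(0,s)`-tensor by a linear map. -/
def pullTens {W : Type*} [AddCommGroup W] [Module ℝ W] {s : ℕ} (f : V →ₗ[ℝ] W)
    (b : Tens W s) : Tens V s :=
  b.compLinearMap (fun _ => f)

/-- The tensor product of two covariant tensors. -/
def tmul {p q : ℕ} (a : Tens V p) (b : Tens V q) : Tens V (p + q) where
  toFun v := a (fun i => v (Fin.castAdd q i)) * b (fun j => v (Fin.natAdd p j))
  map_update_add' := by
    intro inst v i x y
    induction i using Fin.addCases with
    | left i =>
      have h (z : V) : (fun k => Function.update v (Fin.castAdd q i) z (Fin.castAdd q k)) =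
        Function.update (fun k => v (Fin.castAdd q k)) i z :=
          Function.update_comp_eq_of_injective v (Fin.castAdd_injective p q) i z
      have h' (z : V) : (fun k => Function.update v (Fin.castAdd q i) z (Fin.natAdd p k)) =
        fun k => v (Fin.natAdd p k) := by
          funext k
          exact Function.update_of_ne (fun e => by
            have := congrArg Fin.val e
            simp only [Fin.val_natAdd, Fin.val_castAdd] at this
            omega) _ _
      rw [h, h, h, h', h', h', MultilinearMap.map_update_add, add_mul]
    | right i =>
      have h (z : V) : (fun k => Function.update v (Fin.natAdd p i) z (Fin.natAdd p k)) =
        Function.update (fun k => v (Fin.natAdd p k)) i z :=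
          Function.update_comp_eq_of_injective v (Fin.natAdd_injective q p) i z
      have h' (z : V) : (fun k => Function.update v (Fin.natAdd p i) z (Fin.castAdd q k)) =
        fun k => v (Fin.castAdd q k) := by
          funext k
          exact Function.update_of_ne (fun e => by
            have := congrArg Fin.val e
            simp only [Fin.val_natAdd, Fin.val_castAdd] at this
            omega) _ _
      rw [h, h, h, h', h', h', MultilinearMap.map_update_add, mul_add]
  map_update_smul' := by
    intro inst v i c x
    induction i using Fin.addCases with
    | left i =>
      have h (z : V) : (fun k => Function.update v (Fin.castAdd q i) z (Fin.castAdd q k)) =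
        Function.update (fun k => v (Fin.castAdd q k)) i z :=
          Function.update_comp_eq_of_injective v (Fin.castAdd_injective p q) i z
      have h' (z : V) : (fun k => Function.update v (Fin.castAdd q i) z (Fin.natAdd p k)) =
        fun k => v (Fin.natAdd p k) := by
          funext k
          exact Function.update_of_ne (fun e => by
            have := congrArg Fin.val e
            simp only [Fin.val_natAdd, Fin.val_castAdd] at this
            omega) _ _
      rw [h, h, h', h', MultilinearMap.map_update_smul, smul_eq_mul, smul_eq_mul, mul_assoc]
    | right i =>
      have h (z : V) : (fun k => Function.update v (Fin.natAdd p i) z (Fin.natAdd p k)) =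
        Function.update (fun k => v (Fin.natAdd p k)) i z :=
          Function.update_comp_eq_of_injective v (Fin.natAdd_injective q p) i z
      have h' (z : V) : (fun k => Function.update v (Fin.natAdd p i) z (Fin.castAdd q k)) =
        fun k => v (Fin.castAdd q k) := by
          funext k
          exact Function.update_of_ne (fun e => by
            have := congrArg Fin.val e
            simp only [Fin.val_natAdd, Fin.val_castAdd] at this
            omega) _ _
      rw [h, h, h', h', MultilinearMap.map_update_smul, smul_eq_mul, smul_eq_mul,
        mul_left_comm]

/-- A bilinear form as a `(0,2)`-tensor. -/
def ofBilin (g : V →ₗ[ℝ] V →ₗ[ℝ] ℝ) : Tens V 2 where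
  toFun v := g (v 0) (v 1)
  map_update_add' := by
    intro inst v i x y
    obtain rfl : inst = instDecidableEqFin 2 := Subsingleton.elim _ _
    fin_cases i <;> simp
  map_update_smul' := by
    intro inst v i c x
    obtain rfl : inst = instDecidableEqFin 2 := Subsingleton.elim _ _
    fin_cases i <;> simp

/-- The sum over the three `(2,2)`-shuffles fixing slot `0`. -/
def shuffleSum (t : Tens V 4) : Tens V 4 :=
  t - t.domDomCongr (Equiv.swap 1 2) + t.domDomCongr (Equiv.swap 1 2 * Equiv.swap 1 3)

/-- The wedge product of two two-forms, as the signed sum over `(2,2)`-shuffles;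
see `wedgeTwo_apply`. -/
def wedgeTwo (a b : Tens V 2) : Tens V 4 :=
  shuffleSum (tmul a b) + shuffleSum (tmul b a)

theorem tmul_two_apply (a b : Tens V 2) (v : Fin 4 → V) :
    (tmul a b : Tens V (2 + 2)) v = a ![v 0, v 1] * b ![v 2, v 3] := by
  have e (c : Tens V 2) (f : Fin 2 → V) : c f = c ![f 0, f 1] := by
    congr 1
    ext i
    fin_cases i <;> rfl
  change a (fun i => v (Fin.castAdd 2 i)) * b (fun j => v (Fin.natAdd 2 j)) = _
  rw [e a, e b]
  rfl

theorem wedgeTwo_apply (a b : Tens V 2) (v : Fin 4 → V) :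
    wedgeTwo a b v =
      a ![v 0, v 1] * b ![v 2, v 3] - a ![v 0, v 2] * b ![v 1, v 3]
        + a ![v 0, v 3] * b ![v 1, v 2] + a ![v 1, v 2] * b ![v 0, v 3]
        - a ![v 1, v 3] * b ![v 0, v 2] + a ![v 2, v 3] * b ![v 0, v 1] := by
  have key (a b : Tens V 2) : shuffleSum (tmul a b) v =
      a ![v 0, v 1] * b ![v 2, v 3] - a ![v 0, v 2] * b ![v 1, v 3]
        + a ![v 0, v 3] * b ![v 1, v 2] :=
    congrArg₂ (· + ·) (congrArg₂ (· - ·) (tmul_two_apply a b v)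
      (tmul_two_apply a b fun i => v (Equiv.swap 1 2 i)))
      (tmul_two_apply a b fun i => v ((Equiv.swap 1 2 * Equiv.swap 1 3 : Equiv.Perm (Fin 4)) i))
  have h : wedgeTwo a b v = shuffleSum (tmul a b) v + shuffleSum (tmul b a) v := rfl
  rw [h, key, key]
  ring

/-! ### Quaternion-Hermitian vector spaces -/

/-- `g` is an inner product and `I, J, K` are `g`-orthogonal endomorphisms with
`I² = J² = -1` and `K = IJ = -JI`. -/
structure IsQuaternionHermitian (g : V →ₗ[ℝ] V →ₗ[ℝ] ℝ) (I J K : V →ₗ[ℝ] V) : Prop where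
  symm : ∀ X Y, g X Y = g Y X
  pos : ∀ X, X ≠ 0 → 0 < g X X
  I_sq : ∀ X, I (I X) = -X
  J_sq : ∀ X, J (J X) = -X
  K_eq : ∀ X, K X = I (J X)
  anti : ∀ X, I (J X) = -J (I X)
  I_orth : ∀ X Y, g (I X) (I Y) = g X Y
  J_orth : ∀ X Y, g (J X) (J Y) = g X Y
  K_orth : ∀ X Y, g (K X) (K Y) = g X Y

/-- The Kähler form `ω_A (X,Y) = g (X, A Y)`. -/
def kahler (g : V →ₗ[ℝ] V →ₗ[ℝ] ℝ) (A : V →ₗ[ℝ] V) : Tens V 2 :=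
  ofBilin (g.compl₂ A)

/-- The fundamental four-form `ω_I ∧ ω_I + ω_J ∧ ω_J + ω_K ∧ ω_K`. -/
def fundForm (g : V →ₗ[ℝ] V →ₗ[ℝ] ℝ) (I J K : V →ₗ[ℝ] V) : Tens V 4 :=
  wedgeTwo (kahler g I) (kahler g I) + wedgeTwo (kahler g J) (kahler g J)
    + wedgeTwo (kahler g K) (kahler g K)

open Classical in
/-- The inner product `∑ i j, a (e_i, e_j) b (e_i, e_j)` of two `(0,2)`-tensors, `e` being a
`g`-orthonormal basis. (For an inner product `g` on a finite-dimensional space such a basis exists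
and the value does not depend on it.) -/
def innerTwo (g : V →ₗ[ℝ] V →ₗ[ℝ] ℝ) (a b : Tens V 2) : ℝ :=
  if h : ∃ e : Module.Basis (Fin (Module.finrank ℝ V)) ℝ V,
      ∀ i j, g (e i) (e j) = if i = j then 1 else 0 then
    ∑ i, ∑ j, a ![h.choose i, h.choose j] * b ![h.choose i, h.choose j]
  else 0

theorem innerTwo_add (g : V →ₗ[ℝ] V →ₗ[ℝ] ℝ) (a a' b : Tens V 2) :
    innerTwo g (a + a') b = innerTwo g a b + innerTwo g a' b := by
  unfold innerTwo
  split_ifs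
  · simp only [add_apply, add_mul, Finset.sum_add_distrib]
  · simp

theorem innerTwo_smul (g : V →ₗ[ℝ] V →ₗ[ℝ] ℝ) (c : ℝ) (a b : Tens V 2) :
    innerTwo g (c • a) b = c * innerTwo g a b := by
  unfold innerTwo
  split_ifs
  · simp only [smul_apply, smul_eq_mul, Finset.mul_sum, mul_assoc]
  · simp

/-- The one-form `X ↦ ⟨T (X, ·, ·), b⟩`. -/
def innerForm (g : V →ₗ[ℝ] V →ₗ[ℝ] ℝ) (T : Tens V 3) (b : Tens V 2) : V →ₗ[ℝ] ℝ where
  toFun X := innerTwo g (T.curryLeft X) b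
  map_add' X Y := by rw [map_add, innerTwo_add]
  map_smul' c X := by rw [map_smul, innerTwo_smul]; rfl

/-- A linear function as a `(0,1)`-tensor. -/
def ofLin (a : V →ₗ[ℝ] ℝ) : Tens V 1 :=
  MultilinearMap.ofSubsingleton ℝ V ℝ 0 a

/-! ### Isotypic components under `Sp(1)`

`Sp(1)`, the unit quaternions, acts on `V` through `i ↦ I`, `j ↦ J`, `k ↦ K`, and on tensors by
`(q · b) (X_1,…) = b (q⁻¹ X_1,…)`; the infinitesimal action of `I`, `J`, `K` is `derAct`.
It acts on `H = ℍ` by `q · ζ = ζ q̄`; the infinitesimal action of a unit imaginary quaternion `u`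
is `ζ ↦ - ζ u`. The complex structure of `H` is left multiplication by `i`. -/

/-- `B` is (the multilinear form of) an `Sp(1)`-equivariant real-linear map from the complex
symmetric power `S^k H` to the `(0,s)`-tensors: it is symmetric, complex-balanced, and commutes with
the action of the Lie algebra of the connected group `Sp(1)`. -/
structure IsEquivariantOnSymPower (I J K : V →ₗ[ℝ] V) {k s : ℕ}
    (B : MultilinearMap ℝ (fun _ : Fin k => ℍ[ℝ]) (Tens V s)) : Prop where
  symm : ∀ (σ : Equiv.Perm (Fin k)) (ζ : Fin k → ℍ[ℝ]), B (fun a => ζ (σ a)) = B ζ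
  balanced : ∀ (a b : Fin k) (ζ : Fin k → ℍ[ℝ]),
    B (Function.update ζ a (⟨0, 1, 0, 0⟩ * ζ a)) = B (Function.update ζ b (⟨0, 1, 0, 0⟩ * ζ b))
  equiv_I : ∀ ζ : Fin k → ℍ[ℝ],
    ∑ a, B (Function.update ζ a (-(ζ a * ⟨0, 1, 0, 0⟩))) = derAct I (B ζ)
  equiv_J : ∀ ζ : Fin k → ℍ[ℝ],
    ∑ a, B (Function.update ζ a (-(ζ a * ⟨0, 0, 1, 0⟩))) = derAct J (B ζ)
  equiv_K : ∀ ζ : Fin k → ℍ[ℝ],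
    ∑ a, B (Function.update ζ a (-(ζ a * ⟨0, 0, 0, 1⟩))) = derAct K (B ζ)

/-- The `S^k H`-isotypic subspace of the `(0,s)`-tensors: the span of the images of all
`Sp(1)`-equivariant maps from `S^k H`. -/
def isotypic (I J K : V →ₗ[ℝ] V) (k s : ℕ) : Submodule ℝ (Tens V s) :=
  Submodule.span ℝ {T | ∃ B : MultilinearMap ℝ (fun _ : Fin k => ℍ[ℝ]) (Tens V s),
    IsEquivariantOnSymPower I J K B ∧ ∃ ζ, T = B ζ}

open Classical in
/-- The `S^k H`-part of a tensor `T`: the element `S` of the `S^k H`-isotypic subspace such that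
`T - S` lies in the sum of the other isotypic subspaces. -/
def part (I J K : V →ₗ[ℝ] V) (k : ℕ) {s : ℕ} (T : Tens V s) : Tens V s :=
  if h : ∃ S ∈ isotypic I J K k s, T - S ∈ ⨆ l : {l : ℕ // l ≠ k}, isotypic I J K l s then
    h.choose
  else 0

end Algebra

/-! ### Covariant derivatives of tensor fields -/

section Geometry

variable {E : Type*} [NormedAddCommGroup E] [NormedSpace ℝ E]
  {H : Type*} [TopologicalSpace H] {IM : ModelWithCorners ℝ E H}
  {M : Type*} [TopologicalSpace M] [ChartedSpace H M] [IsManifold IM ∞ M]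

/-- `D` is the covariant derivative at `x` of the `(0,s)`-tensor field `T`: for all vector fields
`V_1,…,V_s` that are differentiable at `x`,
`D (X, V_1,…,V_s) = X (T (V_1,…,V_s)) - ∑ i, T (V_1,…,∇_X V_i,…,V_s)`. -/
def HasCovDerivAt (nabla : CovariantDerivative IM E (fun x : M => TangentSpace IM x)) {s : ℕ}
    (T : ∀ x : M, Tens (TangentSpace IM x) s) (x : M) (D : Tens (TangentSpace IM x) (s + 1)) :
    Prop :=
  ∀ V : Fin s → ∀ y : M, TangentSpace IM y,
    (∀ i, MDifferentiableAt IM (IM.prod 𝓘(ℝ, E))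
      (fun y => (⟨y, V i y⟩ : TangentBundle IM M)) x) →
    MDifferentiableAt IM 𝓘(ℝ, ℝ) (fun y => T y (fun i => V i y)) x ∧
    ∀ X : TangentSpace IM x,
      D (Fin.cons X (fun i => V i x)) =
        mvfderiv IM (fun y => T y (fun i => V i y)) x X
          - ∑ i, T x (Function.update (fun j => V j x) i (nabla (V i) x X))

open Classical in
/-- The covariant derivative `∇T` of a tensor field at a point (`0` if it does not exist). The
direction of differentiation is slot `0`. -/
def covDeriv (nabla : CovariantDerivative IM E (fun x : M => TangentSpace IM x)) {s : ℕ}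
    (T : ∀ x : M, Tens (TangentSpace IM x) s) (x : M) : Tens (TangentSpace IM x) (s + 1) :=
  if h : ∃ D, HasCovDerivAt nabla T x D then h.choose else 0

/-- A Riemannian metric at a point, as a bilinear form. -/
def metricAt (g : Bundle.ContMDiffRiemannianMetric IM ∞ E (fun x : M => TangentSpace IM x))
    (x : M) : TangentSpace IM x →ₗ[ℝ] TangentSpace IM x →ₗ[ℝ] ℝ :=
  LinearMap.mk₂ ℝ (fun X Y => g.inner x X Y) (by simp) (by simp) (by simp) (by simp)

/-- `nabla` is the Levi-Civita connection of `g`: it is metric and torsion-free. -/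
structure IsLeviCivita [FiniteDimensional ℝ E]
    (g : Bundle.ContMDiffRiemannianMetric IM ∞ E (fun x : M => TangentSpace IM x))
    (nabla : CovariantDerivative IM E (fun x : M => TangentSpace IM x)) : Prop where
  metric : ∀ (x : M) (V W : ∀ y : M, TangentSpace IM y),
    MDifferentiableAt IM (IM.prod 𝓘(ℝ, E)) (fun y => (⟨y, V y⟩ : TangentBundle IM M)) x →
    MDifferentiableAt IM (IM.prod 𝓘(ℝ, E)) (fun y => (⟨y, W y⟩ : TangentBundle IM M)) x →
    ∀ X : TangentSpace IM x,
      mvfderiv IM (fun y => g.inner y (V y) (W y)) x X =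
        g.inner x (nabla V x X) (W x) + g.inner x (V x) (nabla W x X)
  torsion_free : nabla.torsion = 0

/-! ### Almost quaternion-Hermitian manifolds -/

/-- A field of endomorphisms of the tangent spaces. -/
abbrev EndField (IM : ModelWithCorners ℝ E H) (M : Type*) [TopologicalSpace M]
    [ChartedSpace H M] : Type _ :=
  ∀ x : M, TangentSpace IM x →L[ℝ] TangentSpace IM x

/-- The endomorphism field `A` is smooth on `U`. -/
def SmoothEndOn (A : EndField IM M) (U : Set M) : Prop :=
  ContMDiffOn IM (IM.prod 𝓘(ℝ, E →L[ℝ] E)) ∞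
    (fun x => Bundle.TotalSpace.mk' (E →L[ℝ] E)
      (E := fun x : M => TangentSpace IM x →L[ℝ] TangentSpace IM x) x (A x)) U

/-- `I, J, K` is an adapted basis, on `U`, of the family `G` of subspaces of the endomorphisms of
the tangent spaces. -/
structure IsAdaptedBasisOn
    (g : Bundle.ContMDiffRiemannianMetric IM ∞ E (fun x : M => TangentSpace IM x))
    (G : ∀ x : M, Submodule ℝ (TangentSpace IM x →L[ℝ] TangentSpace IM x))
    (U : Set M) (I J K : EndField IM M) : Prop where
  smooth_I : SmoothEndOn I U
  smooth_J : SmoothEndOn J U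
  smooth_K : SmoothEndOn K U
  hermitian : ∀ x ∈ U, IsQuaternionHermitian (metricAt g x) (I x).toLinearMap (J x).toLinearMap
    (K x).toLinearMap
  span_eq : ∀ x ∈ U, G x = Submodule.span ℝ {I x, J x, K x}

/-- `G` is a rank-three subbundle of `End TM` making `(M, g)` almost quaternion-Hermitian. -/
def IsAlmostQuaternionHermitian
    (g : Bundle.ContMDiffRiemannianMetric IM ∞ E (fun x : M => TangentSpace IM x))
    (G : ∀ x : M, Submodule ℝ (TangentSpace IM x →L[ℝ] TangentSpace IM x)) : Prop :=
  ∀ x : M, ∃ U : Set M, IsOpen U ∧ x ∈ U ∧ ∃ I J K : EndField IM M, IsAdaptedBasisOn g G U I J K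

variable (g : Bundle.ContMDiffRiemannianMetric IM ∞ E (fun x : M => TangentSpace IM x))
  (nabla : CovariantDerivative IM E (fun x : M => TangentSpace IM x))

/-- `∇ω_A` at `x`. -/
def nablaKahler (A : EndField IM M) (x : M) : Tens (TangentSpace IM x) 3 :=
  covDeriv nabla (fun y => kahler (metricAt g y) (A y).toLinearMap) x

/-- `∇Ω` at `x`, where `Ω = ω_I ∧ ω_I + ω_J ∧ ω_J + ω_K ∧ ω_K`. -/
def nablaOmega (I J K : EndField IM M) (x : M) : Tens (TangentSpace IM x) 5 :=
  covDeriv nabla (fun y => fundForm (metricAt g y) (I y).toLinearMap (J y).toLinearMap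
    (K y).toLinearMap) x

/-- The one-form `λ_I (X) = ⟨∇_X ω_J, ω_K⟩ / (dim M)`, from the pair `(J, K)`. -/
def lam (J K : EndField IM M) (x : M) : Tens (TangentSpace IM x) 1 :=
  ofLin ((1 / (Module.finrank ℝ E : ℝ)) •
    innerForm (metricAt g x) (nablaKahler g nabla J x) (kahler (metricAt g x) (K x).toLinearMap))

/-- The tensor `α_I = - λ_I ⊗ g + ½ (J_(2) - J_(3)) ∇ω_K`, from the pair `(J, K)`; the
tensors `α_J` and `α_K` come from the pairs `(K, I)` and `(I, J)`. -/
def alpha (J K : EndField IM M) (x : M) : Tens (TangentSpace IM x) 3 :=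
  -(tmul (lam g nabla J K x) (ofBilin (metricAt g x)) : Tens (TangentSpace IM x) (1 + 2))
    + (1 / 2 : ℝ) • (slotAct (J x).toLinearMap 1 (nablaKahler g nabla K x)
      - slotAct (J x).toLinearMap 2 (nablaKahler g nabla K x))

/-- The tensor `I_(1) α_I` (`I` acts on the slot of the direction of differentiation). The tensors
`J_(1) α_J` and `K_(1) α_K` are obtained from the cyclic permutations `(J, K, I)` and
`(K, I, J)` of `(I, J, K)`. -/
def twistedAlpha (I J K : EndField IM M) (x : M) : Tens (TangentSpace IM x) 3 :=
  slotAct (I x).toLinearMap 0 (alpha g nabla J K x)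

/-- The `S^k H`-part of `∇Ω` at `x`. -/
def nablaOmegaPart (k : ℕ) (I J K : EndField IM M) (x : M) : Tens (TangentSpace IM x) 5 :=
  part (I x).toLinearMap (J x).toLinearMap (K x).toLinearMap k (nablaOmega g nabla I J K x)

end Geometry

end AQH

end

open scoped Manifold ContDiff Bundle Quaternion

noncomputable section

namespace AQH

/-! Since `∇g = 0`, `∇Ω = 2 ∑ ω_A ∧ ∇ω_A`. Differentiating the quaternion relations shows that `α_I,
α_J, α_K` lie in `T* ⊗ Λ₀²E` (`alphaTens_mem`) and that `J_(2) α_K - K_(2) α_J = ∇ω_I - λ_K ⊗ ω_J +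
λ_J ⊗ ω_K`, with its cyclic permutations (`slotAct_alphaTens_sub`). In the sum over `A` the
`λ`-terms cancel, so `∇Ω` is the image of `(α_I, α_J, α_K)` under one universal linear map
`omegaDer` (`omegaDer_alphaTens`).

On triples from `T* ⊗ Λ₀²E` this map is `Sp(1)`-equivariant: `T*` has type `H`, `Λ₀²E` is trivial,
and the index `I, J, K` of the triple carries the adjoint representation `S²H` (`derAct_omegaDer`).
As `H ⊗ S²H = H ⊕ S³H`, only two parts occur. The contraction `(a, b, c) ↦ I_(1) a + J_(1) b + K_(1)
c` sees exactly the `H`-part, and its kernel, the `S³H`-part, is coordinatized by the differences of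
the three summands (`omegaDer_eq_add`). Explicit equivariant maps from `H` and `S³H` put the two
pieces into the isotypic subspaces (`omegaDer_mem_isotypic_one`, `omegaDer_mem_isotypic_three`). The
Casimir operator is `-k(k+2)` on type `S^k H`, so these subspaces are independent and the pieces are
the parts (`isotypic_iSupIndep`, `part_omegaDer`).

For the converse, `omegaDer` is injective on such triples, as contraction with the Kähler forms
shows (`omegaDer_injOn_symmInvTens`). Everything is natural under isometries, so the maps and their
left inverses can be chosen once, on the model (`exists_partMaps`). -/

theorem update_vec_three {V : Type*} (X Y Z W : V) :
    Function.update ![X, Y, Z] 0 W = ![W, Y, Z] ∧ Function.update ![X, Y, Z] 1 W = ![X, W, Z] ∧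
    Function.update ![X, Y, Z] 2 W = ![X, Y, W] := by
  refine ⟨?_, ?_, ?_⟩ <;> (ext i; fin_cases i <;> rfl)

theorem update_vec_two {V : Type*} (X Y W : V) :
    Function.update ![X, Y] 0 W = ![W, Y] ∧ Function.update ![X, Y] 1 W = ![X, W] := by
  refine ⟨?_, ?_⟩ <;> (ext i; fin_cases i <;> rfl)

/-! ### Slot actions, derivations and wedge products of tensors -/

section TensorCalculus

variable {V : Type*} [AddCommGroup V] [Module ℝ V]

theorem slotAct_apply {s : ℕ} (A : V →ₗ[ℝ] V) (i : Fin s) (b : Tens V s) (v : Fin s → V) :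
    slotAct A i b v = -b (Function.update v i (A (v i))) := by
  have h : (fun j => (Function.update (fun _ => LinearMap.id) i A : Fin s → V →ₗ[ℝ] V) j (v j)) =
      Function.update v i (A (v i)) := by
    funext j
    by_cases hj : j = i
    · subst hj; simp
    · simp [Function.update_of_ne hj]
  change -b (fun j => (Function.update (fun _ => LinearMap.id) i A : Fin s → V →ₗ[ℝ] V) j (v j)) = _
  rw [h]

theorem derAct_apply {s : ℕ} (A : V →ₗ[ℝ] V) (b : Tens V s) (v : Fin s → V) :
    derAct A b v = -∑ i, b (Function.update v i (A (v i))) := by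
  simp [derAct, slotAct_apply]

/-- `slotAct` as a linear map in the tensor. -/
def slotActL {s : ℕ} (A : V →ₗ[ℝ] V) (i : Fin s) : Tens V s →ₗ[ℝ] Tens V s where
  toFun := slotAct A i
  map_add' a b := by ext v; simp [slotAct_apply]; ring
  map_smul' c a := by ext v; simp [slotAct_apply]

/-- `derAct` as a linear map in the tensor. -/
def derActL {s : ℕ} (A : V →ₗ[ℝ] V) : Tens V s →ₗ[ℝ] Tens V s where
  toFun := derAct A
  map_add' a b := by ext v; simp [derAct_apply, Finset.sum_add_distrib]; ring
  map_smul' c a := by ext v; simp [derAct_apply, Finset.mul_sum]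

theorem slotActL_apply {s : ℕ} (A : V →ₗ[ℝ] V) (i : Fin s) (b : Tens V s) :
    slotActL A i b = slotAct A i b := rfl

theorem derActL_apply {s : ℕ} (A : V →ₗ[ℝ] V) (b : Tens V s) :
    derActL A b = derAct A b := rfl

theorem tens_two_eta (a : Tens V 2) (v : Fin 2 → V) : a v = a ![v 0, v 1] := by
  congr 1; ext i; fin_cases i <;> rfl

theorem tens_three_eta (a : Tens V 3) (v : Fin 3 → V) : a v = a ![v 0, v 1, v 2] := by
  congr 1; ext i; fin_cases i <;> rfl

theorem tens_three_ext {a b : Tens V 3} (h : ∀ X Y Z, a ![X, Y, Z] = b ![X, Y, Z]) : a = b := by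
  ext v; rw [tens_three_eta a, tens_three_eta b, h]

theorem slotAct_zero_three (A : V →ₗ[ℝ] V) (b : Tens V 3) (X Y Z : V) :
    slotAct A 0 b ![X, Y, Z] = -b ![A X, Y, Z] := by
  rw [slotAct_apply]; congr 2; ext i; fin_cases i <;> rfl

theorem slotAct_one_three (A : V →ₗ[ℝ] V) (b : Tens V 3) (X Y Z : V) :
    slotAct A 1 b ![X, Y, Z] = -b ![X, A Y, Z] := by
  rw [slotAct_apply]; congr 2; ext i; fin_cases i <;> rfl

theorem slotAct_two_three (A : V →ₗ[ℝ] V) (b : Tens V 3) (X Y Z : V) :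
    slotAct A 2 b ![X, Y, Z] = -b ![X, Y, A Z] := by
  rw [slotAct_apply]; congr 2; ext i; fin_cases i <;> rfl

theorem tens_three_add (b : Tens V 3) (X X' Y Y' Z Z' : V) :
    b ![X + X', Y, Z] = b ![X, Y, Z] + b ![X', Y, Z] ∧
    b ![X, Y + Y', Z] = b ![X, Y, Z] + b ![X, Y', Z] ∧
    b ![X, Y, Z + Z'] = b ![X, Y, Z] + b ![X, Y, Z'] := by
  have h0 := b.map_update_add ![X, Y, Z] 0 X X'
  have h1 := b.map_update_add ![X, Y, Z] 1 Y Y'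
  have h2 := b.map_update_add ![X, Y, Z] 2 Z Z'
  simp only [update_vec_three] at h0 h1 h2
  exact ⟨h0, h1, h2⟩

theorem tens_three_smul (b : Tens V 3) (c : ℝ) (X Y Z : V) :
    b ![c • X, Y, Z] = c * b ![X, Y, Z] ∧ b ![X, c • Y, Z] = c * b ![X, Y, Z] ∧
    b ![X, Y, c • Z] = c * b ![X, Y, Z] := by
  have h0 := b.map_update_smul ![X, Y, Z] 0 c X
  have h1 := b.map_update_smul ![X, Y, Z] 1 c Y
  have h2 := b.map_update_smul ![X, Y, Z] 2 c Z
  simp only [update_vec_three] at h0 h1 h2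
  exact ⟨h0, h1, h2⟩

theorem tens_three_neg (b : Tens V 3) (X Y Z : V) :
    b ![-X, Y, Z] = -b ![X, Y, Z] ∧ b ![X, -Y, Z] = -b ![X, Y, Z] ∧
    b ![X, Y, -Z] = -b ![X, Y, Z] := by
  have := tens_three_smul b (-1) X Y Z
  simpa using this

theorem kahler_apply (g : V →ₗ[ℝ] V →ₗ[ℝ] ℝ) (A : V →ₗ[ℝ] V) (X Y : V) :
    kahler g A ![X, Y] = g X (A Y) := rfl

/-- `wedgeTwo ω` as a linear map. -/
def wedgeTwoL (w : Tens V 2) : Tens V 2 →ₗ[ℝ] Tens V 4 where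
  toFun := wedgeTwo w
  map_add' a b := by ext v; simp [wedgeTwo_apply]; ring
  map_smul' c a := by ext v; simp [wedgeTwo_apply]; ring

/-- The tensor `(X, Y₁, …, Y₄) ↦ (ω ∧ ρ (X, ·, ·)) (Y₁, …, Y₄)`. -/
def wedgeTail (w : Tens V 2) : Tens V 3 →ₗ[ℝ] Tens V 5 where
  toFun r := LinearMap.uncurryLeft ((wedgeTwoL w) ∘ₗ r.curryLeft)
  map_add' a b := by
    ext v
    exact congrArg (fun t : Tens V 4 => t (Fin.tail v))
      (map_add (wedgeTwoL w) (a.curryLeft (v 0)) (b.curryLeft (v 0)))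
  map_smul' c a := by
    ext v
    exact congrArg (fun t : Tens V 4 => t (Fin.tail v))
      (map_smul (wedgeTwoL w) c (a.curryLeft (v 0)))

theorem wedgeTail_cons (w : Tens V 2) (r : Tens V 3) (v : Fin 5 → V) :
    wedgeTail w r v =
      wedgeTwo w (r.curryLeft (v 0)) (Fin.tail v) := rfl

theorem wedgeTail_apply (w : Tens V 2) (r : Tens V 3) (v : Fin 5 → V) :
    wedgeTail w r v =
      w ![v 1, v 2] * r ![v 0, v 3, v 4] - w ![v 1, v 3] * r ![v 0, v 2, v 4]
        + w ![v 1, v 4] * r ![v 0, v 2, v 3] + w ![v 2, v 3] * r ![v 0, v 1, v 4]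
        - w ![v 2, v 4] * r ![v 0, v 1, v 3] + w ![v 3, v 4] * r ![v 0, v 1, v 2] := by
  rw [wedgeTail_cons, wedgeTwo_apply]; rfl

/-- Every shuffle term is a product in which each slot occurs once, so the Leibniz rule holds term
by term; no skew-symmetry of `w` or `r` is needed. -/
theorem derAct_wedgeTail (A : V →ₗ[ℝ] V) (w : Tens V 2) (r : Tens V 3) :
    derAct A (wedgeTail w r) = wedgeTail (derAct A w) r + wedgeTail w (derAct A r) := by
  ext v
  have h2 (X Y : V) : derAct A w ![X, Y] = -(w ![A X, Y] + w ![X, A Y]) := by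
    rw [derAct_apply, Fin.sum_univ_two]
    congr 3 <;> (ext i; fin_cases i <;> rfl)
  have h3 (X Y Z : V) : derAct A r ![X, Y, Z] =
      -(r ![A X, Y, Z] + r ![X, A Y, Z] + r ![X, Y, A Z]) := by
    rw [derAct_apply, Fin.sum_univ_three]
    congr 4 <;> (ext i; fin_cases i <;> rfl)
  rw [derAct_apply, Fin.sum_univ_five]
  simp only [add_apply, wedgeTail_apply, h2, h3]
  simp [Function.update, -Fin.reduceFinMk]
  ring

end TensorCalculus

/-! ### Quaternion-Hermitian algebra and the infinitesimal equivariance of `omegaDer` -/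

section QuaternionicAlgebra

variable {V : Type*} [AddCommGroup V] [Module ℝ V]

theorem IsQuaternionHermitian.mul_table {g : V →ₗ[ℝ] V →ₗ[ℝ] ℝ} {I J K : V →ₗ[ℝ] V}
    (h : IsQuaternionHermitian g I J K) (X : V) :
    I (I X) = -X ∧ J (J X) = -X ∧ K (K X) = -X ∧ I (J X) = K X ∧ J (K X) = I X ∧ K (I X) = J X ∧
    J (I X) = -K X ∧ K (J X) = -I X ∧ I (K X) = -J X := by
  have hJI : ∀ X, J (I X) = -K X := fun X => by rw [h.K_eq, h.anti, neg_neg]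
  refine ⟨h.I_sq X, h.J_sq X, ?_, (h.K_eq X).symm, ?_, ?_, hJI X, ?_, ?_⟩
  · rw [h.K_eq, h.K_eq, h.anti, h.I_sq]; simp [h.J_sq]
  all_goals simp [h.K_eq, hJI, h.I_sq, h.J_sq]

theorem IsQuaternionHermitian.skew {g : V →ₗ[ℝ] V →ₗ[ℝ] ℝ} {I J K : V →ₗ[ℝ] V}
    (h : IsQuaternionHermitian g I J K) (X Y : V) :
    g (I X) Y = -g X (I Y) ∧ g (J X) Y = -g X (J Y) ∧ g (K X) Y = -g X (K Y) := by
  refine ⟨?_, ?_, ?_⟩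
  · have := h.I_orth X (I Y); rw [h.I_sq] at this; simpa [neg_eq_iff_eq_neg] using this
  · have := h.J_orth X (J Y); rw [h.J_sq] at this; simpa [neg_eq_iff_eq_neg] using this
  · have := h.K_orth X (K Y); rw [(h.mul_table Y).2.2.1] at this
    simpa [neg_eq_iff_eq_neg] using this

/-- Thanks to this symmetry, most identities below are proved for `I` only and then rotated. -/
theorem IsQuaternionHermitian.cycle {g : V →ₗ[ℝ] V →ₗ[ℝ] ℝ} {I J K : V →ₗ[ℝ] V}
    (h : IsQuaternionHermitian g I J K) : IsQuaternionHermitian g J K I where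
  symm := h.symm
  pos := h.pos
  I_sq := h.J_sq
  J_sq X := (h.mul_table X).2.2.1
  K_eq X := (h.mul_table X).2.2.2.2.1.symm
  anti X := by obtain ⟨-, -, -, -, h1, -, -, h2, -⟩ := h.mul_table X; rw [h1, h2, neg_neg]
  I_orth := h.J_orth
  J_orth := h.K_orth
  K_orth := h.I_orth

/-- The basis `e` is orthonormal for `g`. -/
def IsOrthonormalBasis (g : V →ₗ[ℝ] V →ₗ[ℝ] ℝ) {m : ℕ} (e : Module.Basis (Fin m) ℝ V) : Prop :=
  ∀ i j, g (e i) (e j) = if i = j then 1 else 0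

/-- `T* ⊗ Λ₀²E`: the `(0,3)`-tensors which are, in the last two slots, symmetric, invariant under
`I` and `J`, and trace-free. -/
def symmInvTens (g : V →ₗ[ℝ] V →ₗ[ℝ] ℝ) (I J : V →ₗ[ℝ] V) : Submodule ℝ (Tens V 3) where
  carrier := {a | (∀ X Y Z, a ![X, Y, Z] = a ![X, Z, Y]) ∧
    (∀ X Y Z, a ![X, I Y, Z] = -a ![X, Y, I Z]) ∧ (∀ X Y Z, a ![X, J Y, Z] = -a ![X, Y, J Z]) ∧
    ∀ (m : ℕ) (e : Module.Basis (Fin m) ℝ V), IsOrthonormalBasis g e →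
      ∀ X, ∑ i, a ![X, e i, e i] = 0}
  zero_mem' := by simp
  add_mem' := by
    rintro a b ⟨a1, a2, a3, a4⟩ ⟨b1, b2, b3, b4⟩
    refine ⟨fun X Y Z => ?_, fun X Y Z => ?_, fun X Y Z => ?_, fun m e he X => ?_⟩
    · simp [a1 X Y Z, b1 X Y Z]
    · simp [a2 X Y Z, b2 X Y Z]; ring
    · simp [a3 X Y Z, b3 X Y Z]; ring
    · simp [Finset.sum_add_distrib, a4 m e he X, b4 m e he X]
  smul_mem' := by
    rintro c a ⟨a1, a2, a3, a4⟩
    refine ⟨fun X Y Z => ?_, fun X Y Z => ?_, fun X Y Z => ?_, fun m e he X => ?_⟩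
    · simp [a1 X Y Z]
    · simp [a2 X Y Z]
    · simp [a3 X Y Z]
    · simp [← Finset.mul_sum, a4 m e he X]

theorem slotAct_zero_mem {g : V →ₗ[ℝ] V →ₗ[ℝ] ℝ} {I J : V →ₗ[ℝ] V} {a : Tens V 3}
    (ha : a ∈ symmInvTens g I J) (A : V →ₗ[ℝ] V) : slotAct A 0 a ∈ symmInvTens g I J := by
  obtain ⟨a1, a2, a3, a4⟩ := ha
  refine ⟨fun X Y Z => ?_, fun X Y Z => ?_, fun X Y Z => ?_, fun m e he X => ?_⟩ <;>
    simp only [slotAct_zero_three]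
  · rw [a1]
  · rw [a2]
  · rw [a3]
  · simp [a4 m e he (A X)]

theorem symmInvTens_cycle {g : V →ₗ[ℝ] V →ₗ[ℝ] ℝ} {I J K : V →ₗ[ℝ] V}
    (h : IsQuaternionHermitian g I J K) {a : Tens V 3} (ha : a ∈ symmInvTens g I J) :
    a ∈ symmInvTens g J K := by
  obtain ⟨a1, a2, a3, a4⟩ := ha
  refine ⟨a1, a3, fun X Y Z => ?_, a4⟩
  rw [h.K_eq, a2, a3, neg_neg, (h.mul_table Z).2.2.2.2.2.2.1, (tens_three_neg a _ _ _).2.2]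

/-- Precomposition reverses products, and the sign in `slotAct` compensates for this: `A ↦ A_(1)`
obeys the same multiplication table as `I, J, K`. -/
theorem slotAct_zero_mul_table {g : V →ₗ[ℝ] V →ₗ[ℝ] ℝ} {I J K : V →ₗ[ℝ] V}
    (h : IsQuaternionHermitian g I J K) (a : Tens V 3) :
    slotAct I 0 (slotAct I 0 a) = -a ∧
    slotAct I 0 (slotAct J 0 a) = slotAct K 0 a ∧ slotAct J 0 (slotAct I 0 a) = -slotAct K 0 a := by
  refine ⟨?_, ?_, ?_⟩ <;> refine tens_three_ext fun X Y Z => ?_ <;>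
    simp [slotAct_zero_three, h.mul_table, tens_three_neg]

/-- The derivative of the four-form `Ω` in the direction of `I ⊗ a + J ⊗ b + K ⊗ c`. -/
def omegaDer (g : V →ₗ[ℝ] V →ₗ[ℝ] ℝ) (I J K : V →ₗ[ℝ] V) :
    (Tens V 3 × Tens V 3 × Tens V 3) →ₗ[ℝ] Tens V 5 :=
  (2 : ℝ) • (wedgeTail (kahler g I) ∘ₗ
      (slotActL J 1 ∘ₗ LinearMap.snd ℝ _ _ ∘ₗ LinearMap.snd ℝ _ _
        - slotActL K 1 ∘ₗ LinearMap.fst ℝ _ _ ∘ₗ LinearMap.snd ℝ _ _)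
    + wedgeTail (kahler g J) ∘ₗ
      (slotActL K 1 ∘ₗ LinearMap.fst ℝ _ _
        - slotActL I 1 ∘ₗ LinearMap.snd ℝ _ _ ∘ₗ LinearMap.snd ℝ _ _)
    + wedgeTail (kahler g K) ∘ₗ
      (slotActL I 1 ∘ₗ LinearMap.fst ℝ _ _ ∘ₗ LinearMap.snd ℝ _ _
        - slotActL J 1 ∘ₗ LinearMap.fst ℝ _ _))

theorem omegaDer_apply (g : V →ₗ[ℝ] V →ₗ[ℝ] ℝ) (I J K : V →ₗ[ℝ] V) (a b c : Tens V 3) :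
    omegaDer g I J K (a, b, c) =
      (2 : ℝ) • (wedgeTail (kahler g I) (slotActL J 1 c - slotActL K 1 b)
        + wedgeTail (kahler g J) (slotActL K 1 a - slotActL I 1 c)
        + wedgeTail (kahler g K) (slotActL I 1 b - slotActL J 1 a)) := rfl

theorem omegaDer_cycle (g : V →ₗ[ℝ] V →ₗ[ℝ] ℝ) (I J K : V →ₗ[ℝ] V) (a b c : Tens V 3) :
    omegaDer g J K I (b, c, a) = omegaDer g I J K (a, b, c) := by
  rw [omegaDer_apply, omegaDer_apply]; abel_nf

theorem derAct_two (A : V →ₗ[ℝ] V) (w : Tens V 2) (X Y : V) :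
    derAct A w ![X, Y] = -(w ![A X, Y] + w ![X, A Y]) := by
  rw [derAct_apply, Fin.sum_univ_two]
  simp only [Matrix.cons_val_zero, Matrix.cons_val_one, update_vec_two]

theorem derAct_three (A : V →ₗ[ℝ] V) (r : Tens V 3) (X Y Z : V) :
    derAct A r ![X, Y, Z] = -(r ![A X, Y, Z] + r ![X, A Y, Z] + r ![X, Y, A Z]) := by
  rw [derAct_apply, Fin.sum_univ_three]
  simp [update_vec_three]

theorem tens_two_ext {a b : Tens V 2} (h : ∀ X Y, a ![X, Y] = b ![X, Y]) : a = b := by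
  ext v; rw [tens_two_eta a, tens_two_eta b, h]

theorem derAct_kahler {g : V →ₗ[ℝ] V →ₗ[ℝ] ℝ} {I J K : V →ₗ[ℝ] V}
    (h : IsQuaternionHermitian g I J K) :
    derAct I (kahler g I) = 0 ∧ derAct I (kahler g J) = (2 : ℝ) • kahler g K ∧
    derAct I (kahler g K) = (-2 : ℝ) • kahler g J := by
  refine ⟨?_, ?_, ?_⟩ <;> refine tens_two_ext fun X Y => ?_ <;>
    simp [derAct_two, kahler_apply, (h.skew _ _).1, h.mul_table] <;> ring

/-- The action of `I` on the last two slots of `a` is zero. What remains is its action on slot `0`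
and the commutators `[I, J] = 2K`, `[I, K] = -2J`. -/
theorem derAct_slotAct_one {g : V →ₗ[ℝ] V →ₗ[ℝ] ℝ} {I J K : V →ₗ[ℝ] V}
    (h : IsQuaternionHermitian g I J K) {a : Tens V 3} (ha : a ∈ symmInvTens g I J) :
    derAct I (slotAct I 1 a) = slotAct I 1 (slotAct I 0 a) ∧
    derAct I (slotAct J 1 a) = slotAct J 1 (slotAct I 0 a) + (2 : ℝ) • slotAct K 1 a ∧
    derAct I (slotAct K 1 a) = slotAct K 1 (slotAct I 0 a) - (2 : ℝ) • slotAct J 1 a := by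
  obtain ⟨a1, a2, a3, a4⟩ := ha
  have a2' : ∀ X Y Z, a ![X, Y, I Z] = -a ![X, I Y, Z] := fun X Y Z => by rw [a2, neg_neg]
  refine ⟨?_, ?_, ?_⟩ <;> refine tens_three_ext fun X Y Z => ?_ <;>
    simp [derAct_three, slotAct_zero_three, slotAct_one_three, h.mul_table, a2', tens_three_neg] <;>
    ring

/-- The triple stands for `I ⊗ a + J ⊗ b + K ⊗ c`: `I` acts on the coefficients through slot `0` and
on the factors `I, J, K` by the commutator, whence the terms `-2c` and `2b`. -/
theorem derAct_omegaDer {g : V →ₗ[ℝ] V →ₗ[ℝ] ℝ} {I J K : V →ₗ[ℝ] V}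
    (h : IsQuaternionHermitian g I J K) {a b c : Tens V 3} (ha : a ∈ symmInvTens g I J)
    (hb : b ∈ symmInvTens g I J) (hc : c ∈ symmInvTens g I J) :
    derAct I (omegaDer g I J K (a, b, c)) = omegaDer g I J K
      (slotAct I 0 a, slotAct I 0 b - (2 : ℝ) • c, slotAct I 0 c + (2 : ℝ) • b) := by
  obtain ⟨w1, w2, w3⟩ := derAct_kahler h
  obtain ⟨-, a2, a3⟩ := derAct_slotAct_one h ha
  obtain ⟨b1, b2, b3⟩ := derAct_slotAct_one h hb
  obtain ⟨c1, c2, c3⟩ := derAct_slotAct_one h hc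
  have hs (w : Tens V 2) (t : ℝ) (r : Tens V 3) : wedgeTail (t • w) r = t • wedgeTail w r := by
    ext v; simp [wedgeTail_apply]; ring
  have h0 (r : Tens V 3) : wedgeTail 0 r = 0 := by
    ext v; simp [wedgeTail_apply]
  rw [omegaDer_apply, omegaDer_apply, ← derActL_apply, map_smul, map_add, map_add]
  simp only [derActL_apply, derAct_wedgeTail, w1, w2, w3, hs, h0]
  simp only [← derActL_apply, map_sub]
  simp only [derActL_apply, slotActL_apply, a2, a3, b1, b3, c1, c2]
  simp only [← slotActL_apply, map_add, map_sub, map_smul]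
  module

end QuaternionicAlgebra

/-! ### Casimir operator and independence of the isotypic subspaces -/

section Isotypic

variable {V : Type*} [AddCommGroup V] [Module ℝ V]

/-- The quaternion unit `i`. -/
def quatI : ℍ[ℝ] := ⟨0, 1, 0, 0⟩

/-- The quaternion unit `j`. -/
def quatJ : ℍ[ℝ] := ⟨0, 0, 1, 0⟩

/-- The quaternion unit `k`. -/
def quatK : ℍ[ℝ] := ⟨0, 0, 0, 1⟩

@[simp]
theorem quatI_re : quatI.re = 0 := rfl
@[simp]
theorem quatI_imI : quatI.imI = 1 := rfl
@[simp]
theorem quatI_imJ : quatI.imJ = 0 := rfl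
@[simp]
theorem quatI_imK : quatI.imK = 0 := rfl
@[simp]
theorem quatJ_re : quatJ.re = 0 := rfl
@[simp]
theorem quatJ_imI : quatJ.imI = 0 := rfl
@[simp]
theorem quatJ_imJ : quatJ.imJ = 1 := rfl
@[simp]
theorem quatJ_imK : quatJ.imK = 0 := rfl
@[simp]
theorem quatK_re : quatK.re = 0 := rfl
@[simp]
theorem quatK_imI : quatK.imI = 0 := rfl
@[simp]
theorem quatK_imJ : quatK.imJ = 0 := rfl
@[simp]
theorem quatK_imK : quatK.imK = 1 := rfl

theorem quat_unit_sq : quatI * quatI = -1 ∧ quatJ * quatJ = -1 ∧ quatK * quatK = -1 := by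
  refine ⟨?_, ?_, ?_⟩ <;> ext <;> simp

/-- The Casimir operator `I² + J² + K²` of the infinitesimal action on tensors. -/
def casimir (I J K : V →ₗ[ℝ] V) (s : ℕ) : Module.End ℝ (Tens V s) :=
  derActL I ∘ₗ derActL I + derActL J ∘ₗ derActL J + derActL K ∘ₗ derActL K

/-- The mixed part of the Casimir operator on `S²H`. There the Casimir operator is `-8`; each factor
alone contributes `-3`, which leaves `-1` for each of the two mixed terms. -/
theorem quaternion_pair_casimir {W : Type*} [AddCommGroup W] [Module ℝ W]
    (f : ℍ[ℝ] →ₗ[ℝ] ℍ[ℝ] →ₗ[ℝ] W) (hsymm : ∀ p q, f p q = f q p)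
    (hbal : ∀ p q, f (quatI * p) q = f p (quatI * q)) (p q : ℍ[ℝ]) :
    f (-(p * quatI)) (-(q * quatI)) + f (-(p * quatJ)) (-(q * quatJ))
      + f (-(p * quatK)) (-(q * quatK)) = -f p q := by
  have hx (x : ℍ[ℝ]) :
      x = x.re • (1 : ℍ[ℝ]) + x.imI • quatI + x.imJ • quatJ + x.imK • quatK := by
    ext <;> simp
  have h1 (x : ℍ[ℝ]) : -(x * quatI) =
      x.imI • (1 : ℍ[ℝ]) + (-x.re) • quatI + (-x.imK) • quatJ + x.imJ • quatK := by
    ext <;> simp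
  have h2 (x : ℍ[ℝ]) : -(x * quatJ) =
      x.imJ • (1 : ℍ[ℝ]) + x.imK • quatI + (-x.re) • quatJ + (-x.imI) • quatK := by
    ext <;> simp
  have h3 (x : ℍ[ℝ]) : -(x * quatK) =
      x.imK • (1 : ℍ[ℝ]) + (-x.imJ) • quatI + x.imI • quatJ + (-x.re) • quatK := by
    ext <;> simp
  have m0 : quatI * 1 = quatI := mul_one _
  have m1 : quatI * quatI = -1 := quat_unit_sq.1
  have m2 : quatI * quatJ = quatK := by ext <;> simp
  have m3 : quatI * quatK = -quatJ := by ext <;> simp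
  -- Symmetry leaves ten values on pairs of basis units; these four balance relations reduce them to
  -- six, the real dimension of `S²H`.
  have b01 := hbal 1 quatI
  have b02 := hbal 1 quatJ
  have b03 := hbal 1 quatK
  have b23 := hbal quatJ quatK
  rw [m0, m1] at b01
  rw [m0, m2] at b02
  rw [m0, m3] at b03
  rw [m2, m3] at b23
  rw [map_neg] at b01 b03 b23
  have hpq : f p q = f (p.re • (1 : ℍ[ℝ]) + p.imI • quatI + p.imJ • quatJ + p.imK • quatK)
      (q.re • (1 : ℍ[ℝ]) + q.imI • quatI + q.imJ • quatJ + q.imK • quatK) := by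
    rw [← hx, ← hx]
  rw [h1, h1, h2, h2, h3, h3, hpq]
  simp only [map_add, map_smul, LinearMap.add_apply, LinearMap.smul_apply]
  rw [hsymm quatI 1, hsymm quatJ 1, hsymm quatK 1, hsymm quatJ quatI, hsymm quatK quatI,
    hsymm quatK quatJ, b01, b02, b03, b23]
  module

theorem IsEquivariantOnSymPower.sum_eq_derAct {I J K : V →ₗ[ℝ] V} {k s : ℕ}
    {B : MultilinearMap ℝ (fun _ : Fin k => ℍ[ℝ]) (Tens V s)}
    (hB : IsEquivariantOnSymPower I J K B) (ζ : Fin k → ℍ[ℝ]) :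
    derAct I (B ζ) = ∑ a, B (Function.update ζ a (-(ζ a * quatI))) ∧
    derAct J (B ζ) = ∑ a, B (Function.update ζ a (-(ζ a * quatJ))) ∧
    derAct K (B ζ) = ∑ a, B (Function.update ζ a (-(ζ a * quatK))) :=
  ⟨(hB.equiv_I ζ).symm, (hB.equiv_J ζ).symm, (hB.equiv_K ζ).symm⟩

/-- Each of the `k` factors gives `-3`, since `i² = j² = k² = -1`, and each of the `k(k-1)` ordered
pairs of distinct factors gives `-1`: in total `-3k - k(k-1) = -k(k+2)`. -/
theorem casimir_apply_equivariant {I J K : V →ₗ[ℝ] V} {k s : ℕ}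
    {B : MultilinearMap ℝ (fun _ : Fin k => ℍ[ℝ]) (Tens V s)}
    (hB : IsEquivariantOnSymPower I J K B) (ζ : Fin k → ℍ[ℝ]) :
    casimir I J K s (B ζ) = (-((k : ℝ) * (k + 2))) • B ζ := by
  have sq (u : ℍ[ℝ]) (hu : u * u = -1) (a : Fin k) :
      B (Function.update (Function.update ζ a (-(ζ a * u))) a
        (-(Function.update ζ a (-(ζ a * u)) a * u))) = -B ζ := by
    have : -(Function.update ζ a (-(ζ a * u)) a * u) = (-1 : ℝ) • ζ a := by
      rw [Function.update_self, neg_mul, neg_neg, mul_assoc, hu]; simp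
    rw [Function.update_idem, this, B.map_update_smul, Function.update_eq_self]; simp
  have pair (a b : Fin k) (hab : b ≠ a) :
      B (Function.update (Function.update ζ a (-(ζ a * quatI))) b
        (-(Function.update ζ a (-(ζ a * quatI)) b * quatI)))
      + B (Function.update (Function.update ζ a (-(ζ a * quatJ))) b
        (-(Function.update ζ a (-(ζ a * quatJ)) b * quatJ)))
      + B (Function.update (Function.update ζ a (-(ζ a * quatK))) b
        (-(Function.update ζ a (-(ζ a * quatK)) b * quatK))) = -B ζ := by
    let f : ℍ[ℝ] →ₗ[ℝ] ℍ[ℝ] →ₗ[ℝ] Tens V s := LinearMap.mk₂ ℝ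
      (fun p q => B (Function.update (Function.update ζ a p) b q))
      (fun p p' q => by
        rw [Function.update_comm hab.symm, Function.update_comm hab.symm,
          Function.update_comm hab.symm, B.map_update_add])
      (fun c p q => by
        rw [Function.update_comm hab.symm, Function.update_comm hab.symm, B.map_update_smul])
      (fun p q q' => by simp only [B.map_update_add])
      (fun c p q => by simp only [B.map_update_smul])
    have hf (p q) : f p q = B (Function.update (Function.update ζ a p) b q) := rfl
    have hsymm (p q) : f p q = f q p := by
      rw [hf, hf, ← hB.symm (Equiv.swap a b)]
      congr 1
      funext c
      by_cases hca : c = a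
      · subst hca; simp [hab.symm]
      by_cases hcb : c = b
      · subst hcb; simp [hab.symm]
      · rw [Equiv.swap_apply_of_ne_of_ne hca hcb]
        simp [Function.update_of_ne hca, Function.update_of_ne hcb]
    have hbal (p q) : f (quatI * p) q = f p (quatI * q) := by
      have : B (Function.update (Function.update (Function.update ζ a p) b q) a
            (quatI * Function.update (Function.update ζ a p) b q a)) =
          B (Function.update (Function.update (Function.update ζ a p) b q) b
            (quatI * Function.update (Function.update ζ a p) b q b)) :=
        hB.balanced a b (Function.update (Function.update ζ a p) b q)
      rw [Function.update_self, Function.update_of_ne hab.symm, Function.update_self,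
        Function.update_idem, Function.update_comm hab.symm, Function.update_comm hab.symm,
        Function.update_idem] at this
      rw [hf, hf, Function.update_comm hab.symm, this, Function.update_comm hab.symm]
    have := quaternion_pair_casimir f hsymm hbal (ζ a) (ζ b)
    simp only [hf, Function.update_eq_self] at this
    simpa only [Function.update_of_ne hab] using this
  have key : casimir I J K s (B ζ) = ∑ a, ∑ b,
      (B (Function.update (Function.update ζ a (-(ζ a * quatI))) b
        (-(Function.update ζ a (-(ζ a * quatI)) b * quatI)))
      + B (Function.update (Function.update ζ a (-(ζ a * quatJ))) b
        (-(Function.update ζ a (-(ζ a * quatJ)) b * quatJ)))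
      + B (Function.update (Function.update ζ a (-(ζ a * quatK))) b
        (-(Function.update ζ a (-(ζ a * quatK)) b * quatK)))) := by
    simp only [casimir, LinearMap.add_apply, LinearMap.comp_apply, derActL_apply, hB.sum_eq_derAct]
    simp only [← derActL_apply, map_sum]
    simp only [derActL_apply, hB.sum_eq_derAct, Finset.sum_add_distrib]
  rw [key]
  have inner (a : Fin k) : (∑ b, (B (Function.update (Function.update ζ a (-(ζ a * quatI))) b
        (-(Function.update ζ a (-(ζ a * quatI)) b * quatI)))
      + B (Function.update (Function.update ζ a (-(ζ a * quatJ))) b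
        (-(Function.update ζ a (-(ζ a * quatJ)) b * quatJ)))
      + B (Function.update (Function.update ζ a (-(ζ a * quatK))) b
        (-(Function.update ζ a (-(ζ a * quatK)) b * quatK))))) =
      (-((k : ℝ) + 2)) • B ζ := by
    rw [← Finset.add_sum_erase _ _ (Finset.mem_univ a),
      Finset.sum_congr rfl fun b hb => pair a b (Finset.ne_of_mem_erase hb),
      sq _ quat_unit_sq.1, sq _ quat_unit_sq.2.1, sq _ quat_unit_sq.2.2, Finset.sum_const,
      Finset.card_erase_of_mem (Finset.mem_univ a), Finset.card_univ, Fintype.card_fin,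
      ← Nat.cast_smul_eq_nsmul ℝ, Nat.cast_sub (by have := a.pos; omega)]
    push_cast
    module
  rw [Finset.sum_congr rfl fun a _ => inner a, Finset.sum_const, Finset.card_univ,
    Fintype.card_fin, ← Nat.cast_smul_eq_nsmul ℝ]
  module

theorem isotypic_le_eigenspace (I J K : V →ₗ[ℝ] V) (k s : ℕ) :
    isotypic I J K k s ≤ (casimir I J K s).eigenspace (-((k : ℝ) * (k + 2))) := by
  refine Submodule.span_le.2 ?_
  rintro T ⟨B, hB, ζ, rfl⟩
  exact Module.End.mem_eigenspace_iff.2 (casimir_apply_equivariant hB ζ)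

/-- The numbers `k(k+2)` are distinct, so different types lie in different eigenspaces of the
Casimir operator. -/
theorem isotypic_iSupIndep (I J K : V →ₗ[ℝ] V) (s : ℕ) :
    iSupIndep fun k : ℕ => isotypic I J K k s := by
  have inj : Function.Injective fun k : ℕ => (-((k : ℝ) * (k + 2))) := by
    intro k l hkl
    have h : (k : ℝ) * (k + 2) = l * (l + 2) := neg_injective hkl
    have : k * (k + 2) = l * (l + 2) := by exact_mod_cast h
    nlinarith [Nat.lt_trichotomy k l]
  exact ((Module.End.eigenspaces_iSupIndep (casimir I J K s)).comp inj).mono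
    fun k => isotypic_le_eigenspace I J K k s

/-- Independence makes the decomposition unique, so the choice in `part` is immaterial and any
decomposition computes it. -/
theorem part_eq {I J K : V →ₗ[ℝ] V} {k s : ℕ} {T S : Tens V s} (hS : S ∈ isotypic I J K k s)
    (hT : T - S ∈ ⨆ l : {l : ℕ // l ≠ k}, isotypic I J K l s) : part I J K k T = S := by
  have hex : ∃ S ∈ isotypic I J K k s, T - S ∈ ⨆ l : {l : ℕ // l ≠ k}, isotypic I J K l s :=
    ⟨S, hS, hT⟩
  rw [part, dif_pos hex]
  obtain ⟨h1, h2⟩ := hex.choose_spec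
  have hd := (isotypic_iSupIndep I J K s) k
  rw [← iSup_subtype (p := fun l => l ≠ k) (f := fun l => isotypic I J K l.1 s)] at hd
  refine sub_eq_zero.1 (Submodule.disjoint_def.1 hd _ (sub_mem h1 hS) ?_)
  have := sub_mem hT h2
  rwa [sub_sub_sub_cancel_left] at this

end Isotypic

/-! ### Explicit equivariant maps from `H` and `S³H` into `ℍ ⊗ Im ℍ` -/

section EquivariantMaps

variable {V : Type*} [AddCommGroup V] [Module ℝ V]

/-- The tensor `(X, Y, Z) ↦ -a (q X, Y, Z)`, where the quaternion `q` acts through `I, J, K`. -/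
def quatTens (I J K : V →ₗ[ℝ] V) (a : Tens V 3) : ℍ[ℝ] →ₗ[ℝ] Tens V 3 where
  toFun q := q.imI • slotAct I 0 a + q.imJ • slotAct J 0 a + q.imK • slotAct K 0 a - q.re • a
  map_add' p q := by
    simp only [Quaternion.imI_add, Quaternion.imJ_add, Quaternion.imK_add, Quaternion.re_add]
    module
  map_smul' c q := by
    simp only [Quaternion.imI_smul, Quaternion.imJ_smul, Quaternion.imK_smul, Quaternion.re_smul,
      smul_eq_mul, RingHom.id_apply]
    module

theorem quatTens_apply (I J K : V →ₗ[ℝ] V) (a : Tens V 3) (q : ℍ[ℝ]) :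
    quatTens I J K a q =
      q.imI • slotAct I 0 a + q.imJ • slotAct J 0 a + q.imK • slotAct K 0 a - q.re • a := rfl

theorem quatTens_mem {g : V →ₗ[ℝ] V →ₗ[ℝ] ℝ} {I J : V →ₗ[ℝ] V} (K : V →ₗ[ℝ] V) {a : Tens V 3}
    (ha : a ∈ symmInvTens g I J) (q : ℍ[ℝ]) : quatTens I J K a q ∈ symmInvTens g I J := by
  rw [quatTens_apply]
  exact sub_mem (add_mem (add_mem (Submodule.smul_mem _ _ (slotAct_zero_mem ha I))
    (Submodule.smul_mem _ _ (slotAct_zero_mem ha J)))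
    (Submodule.smul_mem _ _ (slotAct_zero_mem ha K))) (Submodule.smul_mem _ _ ha)

/-- For fixed `a`, `quatTens` intertwines the representation `q ↦ -(q u)` on `H` with the action on
slot `0`. -/
theorem slotAct_zero_quatTens {g : V →ₗ[ℝ] V →ₗ[ℝ] ℝ} {I J K : V →ₗ[ℝ] V}
    (h : IsQuaternionHermitian g I J K) (a : Tens V 3) (q : ℍ[ℝ]) :
    slotAct I 0 (quatTens I J K a q) = quatTens I J K a (-(q * quatI)) ∧
    slotAct J 0 (quatTens I J K a q) = quatTens I J K a (-(q * quatJ)) ∧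
    slotAct K 0 (quatTens I J K a q) = quatTens I J K a (-(q * quatK)) := by
  obtain ⟨ii, ij, ji⟩ := slotAct_zero_mul_table h a
  obtain ⟨jj, jk, kj⟩ := slotAct_zero_mul_table h.cycle a
  obtain ⟨kk, ki, ik⟩ := slotAct_zero_mul_table h.cycle.cycle a
  refine ⟨?_, ?_, ?_⟩
  all_goals
    rw [quatTens_apply, quatTens_apply, ← slotActL_apply]
    simp only [map_add, map_sub, map_smul, slotActL_apply, ii, ij, ji, jj, jk, kj, kk, ki, ik]
    simp
    module

/-- The map `(p, q, r) ↦ I ⊗ p a + J ⊗ q a + K ⊗ r a`, followed by the derivative of `Ω`. -/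
def quatOmega (g : V →ₗ[ℝ] V →ₗ[ℝ] ℝ) (I J K : V →ₗ[ℝ] V) (a : Tens V 3) :
    ℍ[ℝ] × ℍ[ℝ] × ℍ[ℝ] →ₗ[ℝ] Tens V 5 :=
  omegaDer g I J K ∘ₗ
    (quatTens I J K a).prodMap ((quatTens I J K a).prodMap (quatTens I J K a))

theorem quatOmega_apply (g : V →ₗ[ℝ] V →ₗ[ℝ] ℝ) (I J K : V →ₗ[ℝ] V) (a : Tens V 3)
    (p q r : ℍ[ℝ]) : quatOmega g I J K a (p, q, r) =
      omegaDer g I J K (quatTens I J K a p, quatTens I J K a q, quatTens I J K a r) := rfl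

theorem derAct_quatOmega {g : V →ₗ[ℝ] V →ₗ[ℝ] ℝ} {I J K : V →ₗ[ℝ] V}
    (h : IsQuaternionHermitian g I J K) {a : Tens V 3} (ha : a ∈ symmInvTens g I J)
    (p q r : ℍ[ℝ]) :
    derAct I (quatOmega g I J K a (p, q, r)) = quatOmega g I J K a
      (-(p * quatI), -(q * quatI) - (2 : ℝ) • r, -(r * quatI) + (2 : ℝ) • q) ∧
    derAct J (quatOmega g I J K a (p, q, r)) = quatOmega g I J K a
      (-(p * quatJ) + (2 : ℝ) • r, -(q * quatJ), -(r * quatJ) - (2 : ℝ) • p) ∧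
    derAct K (quatOmega g I J K a (p, q, r)) = quatOmega g I J K a
      (-(p * quatK) - (2 : ℝ) • q, -(q * quatK) + (2 : ℝ) • p, -(r * quatK)) := by
  have m (q) := quatTens_mem K ha q
  have m' (q) := symmInvTens_cycle h (m q)
  have m'' (q) := symmInvTens_cycle h.cycle (m' q)
  refine ⟨?_, ?_, ?_⟩
  · rw [quatOmega_apply, derAct_omegaDer h (m p) (m q) (m r), quatOmega_apply]
    simp only [map_add, map_sub, map_smul, slotAct_zero_quatTens h]
  · rw [quatOmega_apply, ← omegaDer_cycle, derAct_omegaDer h.cycle (m' q) (m' r) (m' p),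
      omegaDer_cycle, quatOmega_apply]
    simp only [map_add, map_sub, map_smul, slotAct_zero_quatTens h]
  · rw [quatOmega_apply, ← omegaDer_cycle, ← omegaDer_cycle,
      derAct_omegaDer h.cycle.cycle (m'' r) (m'' p) (m'' q), omegaDer_cycle, omegaDer_cycle,
      quatOmega_apply]
    simp only [map_add, map_sub, map_smul, slotAct_zero_quatTens h]

/-- Reduces membership in an isotypic subspace to quaternion arithmetic: the hypotheses say that `c`
is an equivariant map from `S^k H` to `ℍ ⊗ Im ℍ`, and `quatOmega` intertwines that target with the
tensors. -/
theorem quatOmega_mem_isotypic {g : V →ₗ[ℝ] V →ₗ[ℝ] ℝ} {I J K : V →ₗ[ℝ] V}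
    (h : IsQuaternionHermitian g I J K) {a : Tens V 3} (ha : a ∈ symmInvTens g I J) {k : ℕ}
    (c : MultilinearMap ℝ (fun _ : Fin k => ℍ[ℝ]) (ℍ[ℝ] × ℍ[ℝ] × ℍ[ℝ]))
    (symm : ∀ (σ : Equiv.Perm (Fin k)) (ζ : Fin k → ℍ[ℝ]), c (fun a => ζ (σ a)) = c ζ)
    (balanced : ∀ (a b : Fin k) (ζ : Fin k → ℍ[ℝ]),
      c (Function.update ζ a (quatI * ζ a)) = c (Function.update ζ b (quatI * ζ b)))
    (equiv_I : ∀ ζ : Fin k → ℍ[ℝ], ∑ a, c (Function.update ζ a (-(ζ a * quatI))) =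
      (-((c ζ).1 * quatI), -((c ζ).2.1 * quatI) - (2 : ℝ) • (c ζ).2.2,
        -((c ζ).2.2 * quatI) + (2 : ℝ) • (c ζ).2.1))
    (equiv_J : ∀ ζ : Fin k → ℍ[ℝ], ∑ a, c (Function.update ζ a (-(ζ a * quatJ))) =
      (-((c ζ).1 * quatJ) + (2 : ℝ) • (c ζ).2.2, -((c ζ).2.1 * quatJ),
        -((c ζ).2.2 * quatJ) - (2 : ℝ) • (c ζ).1))
    (equiv_K : ∀ ζ : Fin k → ℍ[ℝ], ∑ a, c (Function.update ζ a (-(ζ a * quatK))) =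
      (-((c ζ).1 * quatK) - (2 : ℝ) • (c ζ).2.1, -((c ζ).2.1 * quatK) + (2 : ℝ) • (c ζ).1,
        -((c ζ).2.2 * quatK)))
    (ζ : Fin k → ℍ[ℝ]) : quatOmega g I J K a (c ζ) ∈ isotypic I J K k 5 := by
  refine Submodule.subset_span ⟨(quatOmega g I J K a).compMultilinearMap c, ?_, ζ, rfl⟩
  refine ⟨fun σ ζ => congrArg (quatOmega g I J K a) (symm σ ζ),
    fun i j ζ => congrArg (quatOmega g I J K a) (balanced i j ζ), fun ζ => ?_, fun ζ => ?_, fun ζ => ?_⟩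
  · exact ((map_sum (quatOmega g I J K a) _ _).symm.trans (congrArg _ (equiv_I ζ))).trans
      (derAct_quatOmega h ha _ _ _).1.symm
  · exact ((map_sum (quatOmega g I J K a) _ _).symm.trans (congrArg _ (equiv_J ζ))).trans
      (derAct_quatOmega h ha _ _ _).2.1.symm
  · exact ((map_sum (quatOmega g I J K a) _ _).symm.trans (congrArg _ (equiv_K ζ))).trans
      (derAct_quatOmega h ha _ _ _).2.2.symm

/-- The equivariant embedding `ζ ↦ I ⊗ ζ i + J ⊗ ζ j + K ⊗ ζ k` of `H` into `ℍ ⊗ Im ℍ`. -/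
def embedH : ℍ[ℝ] →ₗ[ℝ] ℍ[ℝ] × ℍ[ℝ] × ℍ[ℝ] :=
  (LinearMap.mulRight ℝ quatI).prod
    ((LinearMap.mulRight ℝ quatJ).prod (LinearMap.mulRight ℝ quatK))

theorem quatOmega_embedH_mem {g : V →ₗ[ℝ] V →ₗ[ℝ] ℝ} {I J K : V →ₗ[ℝ] V}
    (h : IsQuaternionHermitian g I J K) {a : Tens V 3} (ha : a ∈ symmInvTens g I J) :
    quatOmega g I J K a (quatI, quatJ, quatK) ∈ isotypic I J K 1 5 := by
  have hc (ζ : Fin 1 → ℍ[ℝ]) :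
      MultilinearMap.ofSubsingleton ℝ ℍ[ℝ] (ℍ[ℝ] × ℍ[ℝ] × ℍ[ℝ]) (0 : Fin 1) embedH ζ =
        (ζ 0 * quatI, ζ 0 * quatJ, ζ 0 * quatK) := rfl
  have := quatOmega_mem_isotypic h ha
    (MultilinearMap.ofSubsingleton ℝ ℍ[ℝ] (ℍ[ℝ] × ℍ[ℝ] × ℍ[ℝ]) (0 : Fin 1) embedH)
    (fun σ ζ => by rw [Subsingleton.elim σ 1]; rfl)
    (fun a b ζ => by rw [Subsingleton.elim a b])
    (fun ζ => by
      simp only [Fin.sum_univ_one, hc, Function.update_self]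
      refine Prod.ext ?_ (Prod.ext ?_ ?_) <;> ext <;> simp <;> ring)
    (fun ζ => by
      simp only [Fin.sum_univ_one, hc, Function.update_self]
      refine Prod.ext ?_ (Prod.ext ?_ ?_) <;> ext <;> simp <;> ring)
    (fun ζ => by
      simp only [Fin.sum_univ_one, hc, Function.update_self]
      refine Prod.ext ?_ (Prod.ext ?_ ?_) <;> ext <;> simp <;> ring)
    (fun _ => 1)
  simpa [hc] using this

/-- A building block of the equivariant map from `S³H` to `ℍ ⊗ Im ℍ`. -/
def cubicTerm (p q r : ℍ[ℝ]) : ℍ[ℝ] × ℍ[ℝ] × ℍ[ℝ] :=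
  ((star q * quatJ * r).imI • p + (star q * quatK * r).imI • (quatI * p),
    (star q * quatJ * r).imJ • p + (star q * quatK * r).imJ • (quatI * p),
    (star q * quatJ * r).imK • p + (star q * quatK * r).imK • (quatI * p))

/-- For imaginary `u`, exchanging `q` and `r` turns `q̄ u r` into minus its conjugate, which has the
same imaginary part. -/
theorem cubicTerm_symm (p q r : ℍ[ℝ]) : cubicTerm p q r = cubicTerm p r q := by
  have h (u : ℍ[ℝ]) (hu : star u = -u) : star r * u * q = -star (star q * u * r) := by
    simp only [star_mul, hu, mul_assoc, star_star, mul_neg, neg_mul, neg_neg]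
  have hj : star quatJ = -quatJ := by ext <;> simp
  have hk : star quatK = -quatK := by ext <;> simp
  simp only [cubicTerm, h _ hj, h _ hk, Quaternion.imI_neg, Quaternion.imJ_neg, Quaternion.imK_neg,
    Quaternion.imI_star, Quaternion.imJ_star, Quaternion.imK_star, neg_neg]

/-- This is why `j` and `k` occur together: replacing `q` by `iq` turns the pair `(q̄ j r, q̄ k r)`
into `(-q̄ k r, q̄ j r)`, which has the same effect as replacing `p` by `ip`. -/
theorem cubicTerm_balanced (p q r : ℍ[ℝ]) :
    cubicTerm p (quatI * q) r = cubicTerm (quatI * p) q r ∧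
    cubicTerm p q (quatI * r) = cubicTerm (quatI * p) q r := by
  have h (p q r : ℍ[ℝ]) : cubicTerm p (quatI * q) r = cubicTerm (quatI * p) q r := by
    have hj : star (quatI * q) * quatJ * r = -(star q * quatK * r) := by
      have : star quatI * quatJ = -quatK := by ext <;> simp
      rw [star_mul, mul_assoc (star q), this]; simp only [mul_neg, neg_mul]
    have hk : star (quatI * q) * quatK * r = star q * quatJ * r := by
      have : star quatI * quatK = quatJ := by ext <;> simp
      rw [star_mul, mul_assoc (star q), this]
    have hi : quatI * (quatI * p) = -p := by rw [← mul_assoc, quat_unit_sq.1, neg_one_mul]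
    simp only [cubicTerm, hj, hk, hi, Quaternion.imI_neg, Quaternion.imJ_neg, Quaternion.imK_neg]
    refine Prod.ext ?_ (Prod.ext ?_ ?_) <;> module
  exact ⟨h p q r, by rw [cubicTerm_symm, h, cubicTerm_symm]⟩

theorem cubicTerm_add_left (p p' q r : ℍ[ℝ]) :
    cubicTerm (p + p') q r = cubicTerm p q r + cubicTerm p' q r := by
  refine Prod.ext ?_ (Prod.ext ?_ ?_) <;> simp only [cubicTerm, mul_add, Prod.fst_add,
    Prod.snd_add] <;> module

theorem cubicTerm_add_right (p q r r' : ℍ[ℝ]) :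
    cubicTerm p q (r + r') = cubicTerm p q r + cubicTerm p q r' := by
  refine Prod.ext ?_ (Prod.ext ?_ ?_) <;> simp only [cubicTerm, mul_add, Prod.fst_add,
    Prod.snd_add, Quaternion.imI_add, Quaternion.imJ_add, Quaternion.imK_add] <;> module

theorem cubicTerm_add_middle (p q q' r : ℍ[ℝ]) :
    cubicTerm p (q + q') r = cubicTerm p q r + cubicTerm p q' r := by
  rw [cubicTerm_symm, cubicTerm_add_right, cubicTerm_symm, cubicTerm_symm p r q']

theorem cubicTerm_smul_left (c : ℝ) (p q r : ℍ[ℝ]) :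
    cubicTerm (c • p) q r = c • cubicTerm p q r := by
  refine Prod.ext ?_ (Prod.ext ?_ ?_) <;> simp only [cubicTerm, mul_smul_comm, Prod.smul_fst,
    Prod.smul_snd] <;> module

theorem cubicTerm_smul_right (c : ℝ) (p q r : ℍ[ℝ]) :
    cubicTerm p q (c • r) = c • cubicTerm p q r := by
  refine Prod.ext ?_ (Prod.ext ?_ ?_) <;> simp only [cubicTerm, mul_smul_comm, Prod.smul_fst,
    Prod.smul_snd, Quaternion.imI_smul, Quaternion.imJ_smul, Quaternion.imK_smul,
    smul_eq_mul] <;> module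

theorem cubicTerm_smul_middle (c : ℝ) (p q r : ℍ[ℝ]) :
    cubicTerm p (c • q) r = c • cubicTerm p q r := by
  rw [cubicTerm_symm, cubicTerm_smul_right, cubicTerm_symm]

/-- As `x̄ = -x`, varying `q` and `r` together produces the commutator of `x` with `q̄ u r`, the
adjoint action on `Im ℍ`; varying `p` gives the action on `ℍ`. -/
theorem cubicTerm_sum (x : ℍ[ℝ]) (hx : star x = -x) (p q r : ℍ[ℝ]) :
    cubicTerm (-(p * x)) q r + cubicTerm p (-(q * x)) r + cubicTerm p q (-(r * x)) =
      (-((cubicTerm p q r).1 * x), -((cubicTerm p q r).2.1 * x), -((cubicTerm p q r).2.2 * x))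
      + ((x * (star q * quatJ * r) - star q * quatJ * r * x).imI • p
          + (x * (star q * quatK * r) - star q * quatK * r * x).imI • (quatI * p),
        (x * (star q * quatJ * r) - star q * quatJ * r * x).imJ • p
          + (x * (star q * quatK * r) - star q * quatK * r * x).imJ • (quatI * p),
        (x * (star q * quatJ * r) - star q * quatJ * r * x).imK • p
          + (x * (star q * quatK * r) - star q * quatK * r * x).imK • (quatI * p)) := by
  have h1 (u : ℍ[ℝ]) : star (-(q * x)) * u * r = x * (star q * u * r) := by
    simp only [star_neg, star_mul, hx, mul_assoc, neg_mul, neg_neg]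
  have h2 (u : ℍ[ℝ]) : star q * u * -(r * x) = -(star q * u * r * x) := by
    simp only [mul_neg, mul_assoc]
  have h3 : quatI * -(p * x) = -((quatI * p) * x) := by simp only [mul_neg, mul_assoc]
  refine Prod.ext ?_ (Prod.ext ?_ ?_) <;> simp only [cubicTerm, h1, h2, h3, Prod.fst_add,
    Prod.snd_add, add_mul, smul_mul_assoc, Quaternion.imI_sub, Quaternion.imJ_sub,
    Quaternion.imK_sub, Quaternion.imI_neg, Quaternion.imJ_neg, Quaternion.imK_neg] <;> module

theorem quat_commutators (u : ℍ[ℝ]) :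
    ((quatI * u - u * quatI).imI = 0 ∧ (quatI * u - u * quatI).imJ = -2 * u.imK ∧
      (quatI * u - u * quatI).imK = 2 * u.imJ) ∧
    ((quatJ * u - u * quatJ).imI = 2 * u.imK ∧ (quatJ * u - u * quatJ).imJ = 0 ∧
      (quatJ * u - u * quatJ).imK = -2 * u.imI) ∧
    ((quatK * u - u * quatK).imI = -2 * u.imJ ∧ (quatK * u - u * quatK).imJ = 2 * u.imI ∧
      (quatK * u - u * quatK).imK = 0) := by
  refine ⟨⟨?_, ?_, ?_⟩, ⟨?_, ?_, ?_⟩, ⟨?_, ?_, ?_⟩⟩ <;> simp <;> ring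

theorem cubicTerm_equivariant (p q r : ℍ[ℝ]) :
    cubicTerm (-(p * quatI)) q r + cubicTerm p (-(q * quatI)) r + cubicTerm p q (-(r * quatI)) =
      (-((cubicTerm p q r).1 * quatI),
        -((cubicTerm p q r).2.1 * quatI) - (2 : ℝ) • (cubicTerm p q r).2.2,
        -((cubicTerm p q r).2.2 * quatI) + (2 : ℝ) • (cubicTerm p q r).2.1) ∧
    cubicTerm (-(p * quatJ)) q r + cubicTerm p (-(q * quatJ)) r + cubicTerm p q (-(r * quatJ)) =
      (-((cubicTerm p q r).1 * quatJ) + (2 : ℝ) • (cubicTerm p q r).2.2,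
        -((cubicTerm p q r).2.1 * quatJ),
        -((cubicTerm p q r).2.2 * quatJ) - (2 : ℝ) • (cubicTerm p q r).1) ∧
    cubicTerm (-(p * quatK)) q r + cubicTerm p (-(q * quatK)) r + cubicTerm p q (-(r * quatK)) =
      (-((cubicTerm p q r).1 * quatK) - (2 : ℝ) • (cubicTerm p q r).2.1,
        -((cubicTerm p q r).2.1 * quatK) + (2 : ℝ) • (cubicTerm p q r).1,
        -((cubicTerm p q r).2.2 * quatK)) := by
  refine ⟨?_, ?_, ?_⟩
  all_goals
    rw [cubicTerm_sum _ (by ext <;> simp)]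
    simp only [quat_commutators, cubicTerm]
    refine Prod.ext ?_ (Prod.ext ?_ ?_) <;> simp only [Prod.fst_add, Prod.snd_add] <;> module

/-- The equivariant trilinear map from `S³H` to `ℍ ⊗ Im ℍ`. -/
def cubicMap : MultilinearMap ℝ (fun _ : Fin 3 => ℍ[ℝ]) (ℍ[ℝ] × ℍ[ℝ] × ℍ[ℝ]) where
  toFun ζ := cubicTerm (ζ 0) (ζ 1) (ζ 2) + cubicTerm (ζ 1) (ζ 2) (ζ 0)
    + cubicTerm (ζ 2) (ζ 0) (ζ 1)
  map_update_add' := by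
    intro inst v i x y
    obtain rfl : inst = instDecidableEqFin 3 := Subsingleton.elim _ _
    fin_cases i <;> simp [cubicTerm_add_left,
      cubicTerm_add_middle, cubicTerm_add_right] <;> abel
  map_update_smul' := by
    intro inst v i c x
    obtain rfl : inst = instDecidableEqFin 3 := Subsingleton.elim _ _
    fin_cases i <;> simp [cubicTerm_smul_left,
      cubicTerm_smul_middle, cubicTerm_smul_right]

theorem cubicMap_apply (ζ : Fin 3 → ℍ[ℝ]) : cubicMap ζ =
    cubicTerm (ζ 0) (ζ 1) (ζ 2) + cubicTerm (ζ 1) (ζ 2) (ζ 0) + cubicTerm (ζ 2) (ζ 0) (ζ 1) := rfl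

theorem quatOmega_cubicMap_mem {g : V →ₗ[ℝ] V →ₗ[ℝ] ℝ} {I J K : V →ₗ[ℝ] V}
    (h : IsQuaternionHermitian g I J K) {a : Tens V 3} (ha : a ∈ symmInvTens g I J)
    (ζ : Fin 3 → ℍ[ℝ]) : quatOmega g I J K a (cubicMap ζ) ∈ isotypic I J K 3 5 := by
  refine quatOmega_mem_isotypic h ha cubicMap (fun σ ζ => ?_) (fun a b ζ => ?_) (fun ζ => ?_)
    (fun ζ => ?_) (fun ζ => ?_) ζ
  · have hσ : (σ 0 = 0 ∧ σ 1 = 1 ∧ σ 2 = 2) ∨ (σ 0 = 1 ∧ σ 1 = 2 ∧ σ 2 = 0) ∨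
        (σ 0 = 2 ∧ σ 1 = 0 ∧ σ 2 = 1) ∨ (σ 0 = 0 ∧ σ 1 = 2 ∧ σ 2 = 1) ∨
        (σ 0 = 1 ∧ σ 1 = 0 ∧ σ 2 = 2) ∨ (σ 0 = 2 ∧ σ 1 = 1 ∧ σ 2 = 0) := by
      revert σ; decide
    have s0 := cubicTerm_symm (ζ 0) (ζ 1) (ζ 2)
    have s1 := cubicTerm_symm (ζ 1) (ζ 2) (ζ 0)
    have s2 := cubicTerm_symm (ζ 2) (ζ 0) (ζ 1)
    rcases hσ with ⟨h0, h1, h2⟩ | ⟨h0, h1, h2⟩ | ⟨h0, h1, h2⟩ | ⟨h0, h1, h2⟩ | ⟨h0, h1, h2⟩ |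
      ⟨h0, h1, h2⟩ <;> simp only [cubicMap_apply, h0, h1, h2, s0, s1, s2] <;> abel
  · have key (a : Fin 3) : cubicMap (Function.update ζ a (quatI * ζ a)) =
        cubicTerm (quatI * ζ 0) (ζ 1) (ζ 2) + cubicTerm (quatI * ζ 1) (ζ 2) (ζ 0)
          + cubicTerm (quatI * ζ 2) (ζ 0) (ζ 1) := by
      fin_cases a <;> simp [cubicMap_apply, cubicTerm_balanced]
    rw [key, key]
  all_goals
    obtain ⟨i0, j0, k0⟩ := cubicTerm_equivariant (ζ 0) (ζ 1) (ζ 2)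
    obtain ⟨i1, j1, k1⟩ := cubicTerm_equivariant (ζ 1) (ζ 2) (ζ 0)
    obtain ⟨i2, j2, k2⟩ := cubicTerm_equivariant (ζ 2) (ζ 0) (ζ 1)
  · have := congrArg₂ (· + ·) (congrArg₂ (· + ·) i0 i1) i2
    rw [Fin.sum_univ_three]
    simp only [cubicMap_apply, Function.update_self, Prod.fst_add, Prod.snd_add] at this ⊢
    refine Eq.trans ?_ (this.trans ?_)
    · simp; abel
    · refine Prod.ext ?_ (Prod.ext ?_ ?_) <;> simp [add_mul, smul_add] <;> abel
  · have := congrArg₂ (· + ·) (congrArg₂ (· + ·) j0 j1) j2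
    rw [Fin.sum_univ_three]
    simp only [cubicMap_apply, Function.update_self, Prod.fst_add, Prod.snd_add] at this ⊢
    refine Eq.trans ?_ (this.trans ?_)
    · simp; abel
    · refine Prod.ext ?_ (Prod.ext ?_ ?_) <;> simp [add_mul, smul_add] <;> abel
  · have := congrArg₂ (· + ·) (congrArg₂ (· + ·) k0 k1) k2
    rw [Fin.sum_univ_three]
    simp only [cubicMap_apply, Function.update_self, Prod.fst_add, Prod.snd_add] at this ⊢
    refine Eq.trans ?_ (this.trans ?_)
    · simp; abel
    · refine Prod.ext ?_ (Prod.ext ?_ ?_) <;> simp [add_mul, smul_add] <;> abel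

/-- Combined with arbitrary coefficient tensors, these two vectors generate every triple killed by
the contraction; see `omegaDer_mem_isotypic_three`. -/
theorem cubicMap_values :
    cubicMap ![1, 1, 1] = (3 : ℝ) • ((0, 1, quatI) : ℍ[ℝ] × ℍ[ℝ] × ℍ[ℝ]) ∧
    cubicMap ![quatI, 1, quatJ] = ((2 : ℝ) • (1 : ℍ[ℝ]), quatK, -quatJ) := by
  refine ⟨?_, ?_⟩ <;> refine Prod.ext ?_ (Prod.ext ?_ ?_) <;>
    simp only [cubicMap_apply, cubicTerm, Prod.fst_add, Prod.snd_add, Prod.smul_fst,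
      Prod.smul_snd] <;> ext <;> simp <;> norm_num

theorem omegaDer_mem_isotypic_one {g : V →ₗ[ℝ] V →ₗ[ℝ] ℝ} {I J K : V →ₗ[ℝ] V}
    (h : IsQuaternionHermitian g I J K) {a : Tens V 3} (ha : a ∈ symmInvTens g I J) :
    omegaDer g I J K (slotAct I 0 a, slotAct J 0 a, slotAct K 0 a) ∈ isotypic I J K 1 5 := by
  simpa [quatOmega_apply, quatTens_apply] using quatOmega_embedH_mem h ha

/-- The relation `hs` expresses `c` through `a` and `b`, so two values of `cubicMap`, with suitable
coefficient tensors, suffice to produce the triple. -/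
theorem omegaDer_mem_isotypic_three {g : V →ₗ[ℝ] V →ₗ[ℝ] ℝ} {I J K : V →ₗ[ℝ] V}
    (h : IsQuaternionHermitian g I J K) {a b c : Tens V 3} (ha : a ∈ symmInvTens g I J)
    (hb : b ∈ symmInvTens g I J) (hs : slotAct I 0 a + slotAct J 0 b + slotAct K 0 c = 0) :
    omegaDer g I J K (a, b, c) ∈ isotypic I J K 3 5 := by
  -- `quatTens` sends the real quaternion `2` to `-2` times its tensor, so `-½ a` makes the first
  -- component `a`. The second becomes `-½ K_(1) a`, which `h2` corrects to `b` without touching the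
  -- first.
  have h1 := quatOmega_cubicMap_mem h (Submodule.smul_mem _ (-(1 / 2) : ℝ) ha) ![quatI, 1, quatJ]
  have h2 := quatOmega_cubicMap_mem h (a := (-(1 / 3) : ℝ) • (b + (1 / 2 : ℝ) • slotAct K 0 a))
    (Submodule.smul_mem _ _ (add_mem hb (Submodule.smul_mem _ _ (slotAct_zero_mem ha K))))
    ![1, 1, 1]
  obtain ⟨-, ij, ji⟩ := slotAct_zero_mul_table h b
  obtain ⟨-, jk, kj⟩ := slotAct_zero_mul_table h.cycle b
  obtain ⟨kk, -, -⟩ := slotAct_zero_mul_table h.cycle.cycle c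
  obtain ⟨-, ki, ik⟩ := slotAct_zero_mul_table h.cycle.cycle a
  have hc : c = slotAct J 0 a - slotAct I 0 b := by
    have := congrArg (slotActL K 0) hs
    simp only [map_add, map_zero, slotActL_apply, ki, kj, kk] at this
    rw [← sub_eq_zero, ← neg_eq_zero, ← this]; abel
  rw [cubicMap_values.2] at h1
  rw [cubicMap_values.1, map_smul] at h2
  have h3 := add_mem h1 h2
  rw [quatOmega_apply, quatOmega_apply, ← map_smul, ← map_add] at h3
  convert h3 using 2
  simp only [quatTens_apply, ← slotActL_apply, map_smul, map_add]
  simp only [slotActL_apply, ik, hc]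
  refine Prod.ext ?_ (Prod.ext ?_ ?_) <;> simp <;> module

end EquivariantMaps

/-! ### Orthonormal bases and traces -/

section Orthonormal

variable {V : Type*} [AddCommGroup V] [Module ℝ V]

theorem IsQuaternionHermitian.exists_orthonormalBasis {g : V →ₗ[ℝ] V →ₗ[ℝ] ℝ}
    {I J K : V →ₗ[ℝ] V} (h : IsQuaternionHermitian g I J K) [FiniteDimensional ℝ V] :
    ∃ e : Module.Basis (Fin (Module.finrank ℝ V)) ℝ V, IsOrthonormalBasis g e := by
  let core : InnerProductSpace.Core ℝ V :=
    { inner := fun x y => g x y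
      conj_inner_symm := fun x y => h.symm y x
      re_inner_nonneg := fun x => by
        by_cases hx : x = 0
        · simp [hx]
        · exact (h.pos x hx).le
      add_left := fun x y z => by simp
      smul_left := fun x y r => by simp
      definite := fun x hx => by
        by_contra hne
        exact (h.pos x hne).ne' hx }
  let _ : NormedAddCommGroup V := core.toNormedAddCommGroup
  let _ : InnerProductSpace ℝ V := InnerProductSpace.ofCore core.toCore
  let b := stdOrthonormalBasis ℝ V
  refine ⟨b.toBasis, fun i j => ?_⟩
  have := orthonormal_iff_ite.1 b.orthonormal i j
  simpa using! this

theorem IsOrthonormalBasis.sum_repr {g : V →ₗ[ℝ] V →ₗ[ℝ] ℝ} {m : ℕ}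
    {e : Module.Basis (Fin m) ℝ V} (he : IsOrthonormalBasis g e) (x : V) :
    ∑ i, g (e i) x • e i = x := by
  conv_rhs => rw [← e.sum_repr x]
  refine Finset.sum_congr rfl fun i _ => ?_
  congr 1
  conv_lhs => rw [← e.sum_repr x]
  simp only [map_sum, map_smul, smul_eq_mul, he i _, mul_ite, mul_one, mul_zero,
    Finset.sum_ite_eq, Finset.mem_univ, if_true]

theorem IsOrthonormalBasis.sum_mul {g : V →ₗ[ℝ] V →ₗ[ℝ] ℝ} {m : ℕ}
    {e : Module.Basis (Fin m) ℝ V} (he : IsOrthonormalBasis g e) (φ : V →ₗ[ℝ] ℝ) (x : V) :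
    ∑ i, g (e i) x * φ (e i) = φ x := by
  conv_rhs => rw [← he.sum_repr x]
  simp

/-- The bilinear form `(Y, Z) ↦ a (X, Y, Z)`. -/
def lastTwo (a : Tens V 3) (X : V) : V →ₗ[ℝ] V →ₗ[ℝ] ℝ :=
  LinearMap.mk₂ ℝ (fun Y Z => a ![X, Y, Z]) (fun Y Y' Z => (tens_three_add a X X Y Y' Z Z).2.1)
    (fun c Y Z => (tens_three_smul a c X Y Z).2.1)
    (fun Y Z Z' => (tens_three_add a X X Y Y Z Z').2.2)
    (fun c Y Z => (tens_three_smul a c X Y Z).2.2)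

theorem lastTwo_apply (a : Tens V 3) (X Y Z : V) : lastTwo a X Y Z = a ![X, Y, Z] := rfl

theorem IsOrthonormalBasis.trace_eq {g : V →ₗ[ℝ] V →ₗ[ℝ] ℝ} (hg : ∀ X Y, g X Y = g Y X) {m m' : ℕ}
    {e : Module.Basis (Fin m) ℝ V} (he : IsOrthonormalBasis g e) {e' : Module.Basis (Fin m') ℝ V}
    (he' : IsOrthonormalBasis g e') (b : V →ₗ[ℝ] V →ₗ[ℝ] ℝ) :
    ∑ i, b (e i) (e i) = ∑ j, b (e' j) (e' j) := by
  have h1 (j : Fin m') : b (e' j) (e' j) = ∑ i, g (e i) (e' j) * b (e i) (e' j) :=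
    (he.sum_mul (b.flip (e' j)) (e' j)).symm
  have h2 (i : Fin m) : b (e i) (e i) = ∑ j, g (e' j) (e i) * b (e i) (e' j) :=
    (he'.sum_mul (b (e i)) (e i)).symm
  simp_rw [h1, h2]
  rw [Finset.sum_comm]
  simp_rw [hg]

end Orthonormal

/-! ### Injectivity of `omegaDer` by contraction with Kähler forms -/

section Injectivity

variable {V : Type*} [AddCommGroup V] [Module ℝ V]

/-- The contraction of `ω_A ∧ r` with `ω_I`. -/
theorem sum_wedgeTail {g : V →ₗ[ℝ] V →ₗ[ℝ] ℝ} {I J K : V →ₗ[ℝ] V}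
    (h : IsQuaternionHermitian g I J K) {m : ℕ} {e : Module.Basis (Fin m) ℝ V}
    (he : IsOrthonormalBasis g e) (A : V →ₗ[ℝ] V) (r : Tens V 3) (X Z W : V) :
    ∑ i, wedgeTail (kahler g A) r ![X, e i, I (e i), Z, W] =
      (∑ i, g (e i) (A (I (e i)))) * r ![X, Z, W] - 2 * r ![X, I (A Z), W]
        + 2 * r ![X, I (A W), Z] + g Z (A W) * ∑ i, r ![X, e i, I (e i)] := by
  have k1 (x y : V) : ∑ i, g (e i) x * r ![X, I (e i), y] = r ![X, I x, y] :=
    he.sum_mul ((lastTwo r X).flip y ∘ₗ I) x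
  have k2 (x y : V) : ∑ i, g (I (e i)) x * r ![X, e i, y] = -r ![X, I x, y] := by
    simp only [(h.skew _ _).1, neg_mul, Finset.sum_neg_distrib]
    exact congrArg Neg.neg (he.sum_mul ((lastTwo r X).flip y) (I x))
  have hv (i : Fin m) : wedgeTail (kahler g A) r ![X, e i, I (e i), Z, W] =
      g (e i) (A (I (e i))) * r ![X, Z, W] - g (e i) (A Z) * r ![X, I (e i), W]
        + g (e i) (A W) * r ![X, I (e i), Z] + g (I (e i)) (A Z) * r ![X, e i, W]
        - g (I (e i)) (A W) * r ![X, e i, Z] + g Z (A W) * r ![X, e i, I (e i)] := by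
    rw [wedgeTail_apply]; rfl
  simp only [hv, Finset.sum_add_distrib, Finset.sum_sub_distrib, ← Finset.sum_mul,
    ← Finset.mul_sum, k1, k2]
  ring

/-- Contraction with `ω_I` isolates the two-form `ρ = J_(2) c - K_(2) b` that is wedged with `ω_I`;
the tensor `a` drops out by symmetry. -/
theorem eq_of_omegaDer_eq_zero {g : V →ₗ[ℝ] V →ₗ[ℝ] ℝ} {I J K : V →ₗ[ℝ] V}
    (h : IsQuaternionHermitian g I J K) {m : ℕ} (hm : 0 < m) {e : Module.Basis (Fin m) ℝ V}
    (he : IsOrthonormalBasis g e) {a b c : Tens V 3} (ha : a ∈ symmInvTens g I J)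
    (hb : b ∈ symmInvTens g I J) (hc : c ∈ symmInvTens g I J)
    (h0 : omegaDer g I J K (a, b, c) = 0) (X Z W : V) : b ![X, K Z, W] = c ![X, J Z, W] := by
  obtain ⟨a1, a2, a3, a4⟩ := ha
  obtain ⟨b1, b2, b3, b4⟩ := hb
  obtain ⟨c1, c2, c3, c4⟩ := hc
  have a5 (X Y Z) : a ![X, K Y, Z] = -a ![X, Y, K Z] := by
    rw [h.K_eq, a2, a3, neg_neg, (h.mul_table Z).2.2.2.2.2.2.1, (tens_three_neg a _ _ _).2.2]
  have b5 (X Y Z) : b ![X, K Y, Z] = -b ![X, Y, K Z] := by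
    rw [h.K_eq, b2, b3, neg_neg, (h.mul_table Z).2.2.2.2.2.2.1, (tens_three_neg b _ _ _).2.2]
  have c5 (X Y Z) : c ![X, K Y, Z] = -c ![X, Y, K Z] := by
    rw [h.K_eq, c2, c3, neg_neg, (h.mul_table Z).2.2.2.2.2.2.1, (tens_three_neg c _ _ _).2.2]
  have za (Y) : a ![X, Y, J Y] = 0 := by have := a3 X Y Y; rw [a1] at this; linarith
  have zb (Y) : b ![X, Y, J Y] = 0 := by have := b3 X Y Y; rw [b1] at this; linarith
  have zc (Y) : c ![X, Y, K Y] = 0 := by have := c5 X Y Y; rw [c1] at this; linarith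
  have za' (Y) : a ![X, Y, K Y] = 0 := by have := a5 X Y Y; rw [a1] at this; linarith
  have g0 (Y) : g Y (J Y) = 0 := by
    have := (h.skew Y Y).2.1; rw [h.symm] at this; linarith
  have g1 (Y) : g Y (K Y) = 0 := by
    have := (h.skew Y Y).2.2; rw [h.symm] at this; linarith
  have key : ∑ i, omegaDer g I J K (a, b, c) ![X, e i, I (e i), Z, W] = 0 := by
    rw [h0]; simp
  simp only [omegaDer_apply, smul_apply, add_apply, smul_eq_mul, ← Finset.mul_sum,
    Finset.sum_add_distrib, sum_wedgeTail h he] at key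
  have tr : ∑ i, g (e i) (e i) = m := by simp [he _ _]
  have tb := b4 m e he X
  have tc := c4 m e he X
  simp only [slotActL_apply, sub_apply, slotAct_one_three, h.mul_table, map_neg, tens_three_neg,
    Finset.sum_neg_distrib, tr, g0, g1, Finset.sum_sub_distrib, b2, b5, c2, c3, a3, a5,
    za, zb, zc, za', tb, tc, neg_neg, Finset.sum_const_zero, neg_zero, mul_zero, zero_mul, add_zero,
    sub_zero] at key
  rw [b5, c3]
  rw [b1 X W, c1 X W, b5, c3, a1 X W Z] at key
  have hm' : (m : ℝ) ≠ 0 := by positivity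
  -- Up to the overall factor `2`, the `ω_I`-term contributes `(4 - m) ρ` and the `ω_J`- and
  -- `ω_K`-terms together `-4ρ`. All traces vanish, so only `-m ρ` is left.
  have hz : (m : ℝ) * (c ![X, Z, J W] - b ![X, Z, K W]) = 0 := by linarith
  have := (mul_eq_zero.1 hz).resolve_left hm'
  linarith

/-- The contraction gives `b (Z, W) = -c (IZ, W)`. The left side is symmetric and the right side
skew in `Z, W`, so both vanish; rotating `I, J, K` kills all three tensors. -/
theorem omegaDer_injOn_symmInvTens {g : V →ₗ[ℝ] V →ₗ[ℝ] ℝ} {I J K : V →ₗ[ℝ] V}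
    (h : IsQuaternionHermitian g I J K) {m : ℕ} (hm : 0 < m) {e : Module.Basis (Fin m) ℝ V}
    (he : IsOrthonormalBasis g e) {a b c : Tens V 3} (ha : a ∈ symmInvTens g I J)
    (hb : b ∈ symmInvTens g I J) (hc : c ∈ symmInvTens g I J)
    (h0 : omegaDer g I J K (a, b, c) = 0) : a = 0 ∧ b = 0 ∧ c = 0 := by
  have key {I J K : V →ₗ[ℝ] V} (h : IsQuaternionHermitian g I J K) {a b c : Tens V 3}
      (ha : a ∈ symmInvTens g I J) (hb : b ∈ symmInvTens g I J) (hc : c ∈ symmInvTens g I J)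
      (h0 : omegaDer g I J K (a, b, c) = 0) : c = 0 := by
    have hbc := eq_of_omegaDer_eq_zero h hm he ha hb hc h0
    have hb' (X Z W : V) : b ![X, Z, W] = -c ![X, I Z, W] := by
      have := hbc X (K Z) W
      simp only [h.mul_table, tens_three_neg] at this
      linarith
    have hc0 (X Z W : V) : c ![X, I Z, W] = 0 := by
      have h1 := hb.1 X Z W
      have h2 := hc.2.1 X W Z
      have h3 := hc.1 X W (I Z)
      rw [hb', hb'] at h1
      linarith
    refine tens_three_ext fun X Y Z => ?_
    have := hc0 X (I Y) Z
    simpa [h.I_sq, tens_three_neg] using this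
  refine ⟨?_, ?_, key h ha hb hc h0⟩
  · exact key h.cycle (symmInvTens_cycle h hb) (symmInvTens_cycle h hc) (symmInvTens_cycle h ha)
      ((omegaDer_cycle g I J K a b c).trans h0)
  · have h' := h.cycle
    refine key h'.cycle (symmInvTens_cycle h' (symmInvTens_cycle h hc))
      (symmInvTens_cycle h' (symmInvTens_cycle h ha)) (symmInvTens_cycle h' (symmInvTens_cycle h hb))
      ?_
    rw [omegaDer_cycle, omegaDer_cycle, h0]

end Injectivity

/-! ### The `H`- and `S³H`-parts as linear maps -/

section Parts

variable {V : Type*} [AddCommGroup V] [Module ℝ V]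

/-- The `H`-part of the derivative of `Ω` in terms of `I_(1) α_I + J_(1) α_J + K_(1) α_K`. -/
def partMapH (g : V →ₗ[ℝ] V →ₗ[ℝ] ℝ) (I J K : V →ₗ[ℝ] V) : Tens V 3 →ₗ[ℝ] Tens V 5 :=
  (-(1 / 3) : ℝ) • (omegaDer g I J K ∘ₗ
    (slotActL I 0).prod ((slotActL J 0).prod (slotActL K 0)))

theorem partMapH_apply (g : V →ₗ[ℝ] V →ₗ[ℝ] ℝ) (I J K : V →ₗ[ℝ] V) (s : Tens V 3) :
    partMapH g I J K s =
      (-(1 / 3) : ℝ) • omegaDer g I J K (slotAct I 0 s, slotAct J 0 s, slotAct K 0 s) := rfl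

/-- The `S³H`-part of the derivative of `Ω` in terms of the pair
`(I_(1) α_I - J_(1) α_J, J_(1) α_J - K_(1) α_K)`. -/
def partMapS (g : V →ₗ[ℝ] V →ₗ[ℝ] ℝ) (I J K : V →ₗ[ℝ] V) :
    Tens V 3 × Tens V 3 →ₗ[ℝ] Tens V 5 :=
  (-(1 / 3) : ℝ) • (omegaDer g I J K ∘ₗ
    (slotActL I 0 ∘ₗ ((2 : ℝ) • LinearMap.fst ℝ _ _ + LinearMap.snd ℝ _ _)).prod
      ((slotActL J 0 ∘ₗ (LinearMap.snd ℝ _ _ - LinearMap.fst ℝ _ _)).prod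
        (slotActL K 0 ∘ₗ (-LinearMap.fst ℝ _ _ - (2 : ℝ) • LinearMap.snd ℝ _ _))))

theorem partMapS_apply (g : V →ₗ[ℝ] V →ₗ[ℝ] ℝ) (I J K : V →ₗ[ℝ] V) (d d' : Tens V 3) :
    partMapS g I J K (d, d') = (-(1 / 3) : ℝ) • omegaDer g I J K
      (slotAct I 0 ((2 : ℝ) • d + d'), slotAct J 0 (d' - d),
        slotAct K 0 (-d - (2 : ℝ) • d')) := rfl

theorem slotAct_zero_sq {g : V →ₗ[ℝ] V →ₗ[ℝ] ℝ} {I J K : V →ₗ[ℝ] V}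
    (h : IsQuaternionHermitian g I J K) (a : Tens V 3) :
    slotAct I 0 (slotAct I 0 a) = -a ∧ slotAct J 0 (slotAct J 0 a) = -a ∧
    slotAct K 0 (slotAct K 0 a) = -a :=
  ⟨(slotAct_zero_mul_table h a).1, (slotAct_zero_mul_table h.cycle a).1,
    (slotAct_zero_mul_table h.cycle.cycle a).1⟩

theorem eq_zero_of_slotAct_zero {g : V →ₗ[ℝ] V →ₗ[ℝ] ℝ} {I J K : V →ₗ[ℝ] V}
    (h : IsQuaternionHermitian g I J K) {a : Tens V 3} (h0 : slotAct I 0 a = 0) : a = 0 := by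
  have := (slotAct_zero_sq h a).1
  rw [h0, ← slotActL_apply, map_zero] at this
  exact neg_eq_zero.1 this.symm

/-- With `x, y, z` the three twisted tensors, `s = x + y + z`, `d = x - y` and `d' = y - z`, one has
`3x = s + 2d + d'`, `3y = s + d' - d`, `3z = s - d - 2d'`. Since `a = -I_(1) x`, and likewise for
`b` and `c`, this accounts for the factor `-1/3` and the coefficients of both maps. -/
theorem omegaDer_eq_add {g : V →ₗ[ℝ] V →ₗ[ℝ] ℝ} {I J K : V →ₗ[ℝ] V}
    (h : IsQuaternionHermitian g I J K) (a b c : Tens V 3) :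
    omegaDer g I J K (a, b, c) =
      partMapH g I J K (slotAct I 0 a + slotAct J 0 b + slotAct K 0 c) +
      partMapS g I J K (slotAct I 0 a - slotAct J 0 b, slotAct J 0 b - slotAct K 0 c) := by
  have ha := (slotAct_zero_sq h a).1
  have hb := (slotAct_zero_sq h b).2.1
  have hc := (slotAct_zero_sq h c).2.2
  rw [partMapH_apply, partMapS_apply, ← map_smul, ← map_smul, ← map_add]
  congr 1
  simp only [← slotActL_apply, map_add, map_sub, map_neg, map_smul] at ha hb hc ⊢
  refine Prod.ext ?_ (Prod.ext ?_ ?_) <;>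
    simp only [Prod.fst_add, Prod.snd_add, Prod.smul_fst, Prod.smul_snd, ha, hb, hc] <;> module

theorem partMapH_mem {g : V →ₗ[ℝ] V →ₗ[ℝ] ℝ} {I J K : V →ₗ[ℝ] V}
    (h : IsQuaternionHermitian g I J K) {s : Tens V 3} (hs : s ∈ symmInvTens g I J) :
    partMapH g I J K s ∈ isotypic I J K 1 5 :=
  Submodule.smul_mem _ _ (omegaDer_mem_isotypic_one h hs)

theorem partMapS_mem {g : V →ₗ[ℝ] V →ₗ[ℝ] ℝ} {I J K : V →ₗ[ℝ] V}
    (h : IsQuaternionHermitian g I J K) {d d' : Tens V 3} (hd : d ∈ symmInvTens g I J)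
    (hd' : d' ∈ symmInvTens g I J) :
    partMapS g I J K (d, d') ∈ isotypic I J K 3 5 := by
  refine Submodule.smul_mem _ _ (omegaDer_mem_isotypic_three h
    (slotAct_zero_mem (add_mem (Submodule.smul_mem _ _ hd) hd') I)
    (slotAct_zero_mem (sub_mem hd' hd) J) ?_)
  change slotAct I 0 (slotAct I 0 ((2 : ℝ) • d + d')) + slotAct J 0 (slotAct J 0 (d' - d))
    + slotAct K 0 (slotAct K 0 (-d - (2 : ℝ) • d')) = 0
  rw [(slotAct_zero_sq h _).1, (slotAct_zero_sq h _).2.1, (slotAct_zero_sq h _).2.2]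
  module

/-- Each of the two summands in `omegaDer_eq_add` is the remainder for the other type. -/
theorem part_omegaDer {g : V →ₗ[ℝ] V →ₗ[ℝ] ℝ} {I J K : V →ₗ[ℝ] V}
    (h : IsQuaternionHermitian g I J K) {a b c : Tens V 3} (ha : a ∈ symmInvTens g I J)
    (hb : b ∈ symmInvTens g I J) (hc : c ∈ symmInvTens g I J) :
    part I J K 1 (omegaDer g I J K (a, b, c)) =
      partMapH g I J K (slotAct I 0 a + slotAct J 0 b + slotAct K 0 c) ∧
    part I J K 3 (omegaDer g I J K (a, b, c)) =
      partMapS g I J K (slotAct I 0 a - slotAct J 0 b, slotAct J 0 b - slotAct K 0 c) := by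
  have mI := slotAct_zero_mem ha I
  have mJ := slotAct_zero_mem hb J
  have mK := slotAct_zero_mem hc K
  have mH := partMapH_mem h (add_mem (add_mem mI mJ) mK)
  have mS := partMapS_mem h (sub_mem mI mJ) (sub_mem mJ mK)
  constructor
  · refine part_eq mH ?_
    rw [omegaDer_eq_add h, add_sub_cancel_left]
    exact Submodule.mem_iSup_of_mem (⟨3, by decide⟩ : {l : ℕ // l ≠ 1}) mS
  · refine part_eq mS ?_
    rw [omegaDer_eq_add h, add_sub_cancel_right]
    exact Submodule.mem_iSup_of_mem (⟨1, by decide⟩ : {l : ℕ // l ≠ 3}) mH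

theorem partMapH_injOn {g : V →ₗ[ℝ] V →ₗ[ℝ] ℝ} {I J K : V →ₗ[ℝ] V}
    (h : IsQuaternionHermitian g I J K) {m : ℕ} (hm : 0 < m) {e : Module.Basis (Fin m) ℝ V}
    (he : IsOrthonormalBasis g e) {s : Tens V 3} (hs : s ∈ symmInvTens g I J)
    (h0 : partMapH g I J K s = 0) : s = 0 := by
  rw [partMapH_apply] at h0
  have h1 := (smul_eq_zero.1 h0).resolve_left (by norm_num)
  exact eq_zero_of_slotAct_zero h (omegaDer_injOn_symmInvTens h hm he (slotAct_zero_mem hs I)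
    (slotAct_zero_mem hs J) (slotAct_zero_mem hs K) h1).1

theorem partMapS_injOn {g : V →ₗ[ℝ] V →ₗ[ℝ] ℝ} {I J K : V →ₗ[ℝ] V}
    (h : IsQuaternionHermitian g I J K) {m : ℕ} (hm : 0 < m) {e : Module.Basis (Fin m) ℝ V}
    (he : IsOrthonormalBasis g e) {d d' : Tens V 3} (hd : d ∈ symmInvTens g I J)
    (hd' : d' ∈ symmInvTens g I J) (h0 : partMapS g I J K (d, d') = 0) : d = 0 ∧ d' = 0 := by
  rw [partMapS_apply] at h0
  have h1 := (smul_eq_zero.1 h0).resolve_left (by norm_num)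
  obtain ⟨e1, e2, -⟩ := omegaDer_injOn_symmInvTens h hm he
    (slotAct_zero_mem (add_mem (Submodule.smul_mem _ (2 : ℝ) hd) hd') I)
    (slotAct_zero_mem (sub_mem hd' hd) J)
    (slotAct_zero_mem (sub_mem (neg_mem hd) (Submodule.smul_mem _ (2 : ℝ) hd')) K) h1
  have f1 := eq_zero_of_slotAct_zero h e1
  have f2 := sub_eq_zero.1 (eq_zero_of_slotAct_zero h.cycle e2)
  subst f2
  have : (3 : ℝ) • d' = 0 := by rw [← f1]; module
  have := (smul_eq_zero.1 this).resolve_left (by norm_num)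
  exact ⟨this, this⟩

end Parts

/-! ### Naturality under isometries, and transfer to the model space -/

section PullBack

variable {V W : Type*} [AddCommGroup V] [Module ℝ V] [AddCommGroup W] [Module ℝ W]

theorem pullTens_apply {s : ℕ} (f : V →ₗ[ℝ] W) (b : Tens W s) (v : Fin s → V) :
    pullTens f b v = b (fun i => f (v i)) := rfl

theorem pullTens_three (f : V →ₗ[ℝ] W) (b : Tens W 3) (X Y Z : V) :
    pullTens f b ![X, Y, Z] = b ![f X, f Y, f Z] := by
  rw [pullTens_apply, tens_three_eta]; rfl

theorem pullTens_slotAct {s : ℕ} (f : V →ₗ[ℝ] W) {A₀ : V →ₗ[ℝ] V} {A : W →ₗ[ℝ] W}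
    (hA : ∀ X, f (A₀ X) = A (f X)) (i : Fin s) (b : Tens W s) :
    pullTens f (slotAct A i b) = slotAct A₀ i (pullTens f b) := by
  ext v
  rw [pullTens_apply, slotAct_apply, slotAct_apply, pullTens_apply]
  congr 2
  funext j
  by_cases hj : j = i
  · subst hj; simp [hA]
  · simp [Function.update_of_ne hj]

theorem pullTens_mem_symmInvTens (f : V ≃ₗ[ℝ] W) {g₀ : V →ₗ[ℝ] V →ₗ[ℝ] ℝ} {I₀ J₀ : V →ₗ[ℝ] V}
    {g : W →ₗ[ℝ] W →ₗ[ℝ] ℝ} {I J : W →ₗ[ℝ] W} (hg : ∀ X Y, g (f X) (f Y) = g₀ X Y)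
    (hI : ∀ X, f (I₀ X) = I (f X)) (hJ : ∀ X, f (J₀ X) = J (f X)) {a : Tens W 3}
    (ha : a ∈ symmInvTens g I J) : pullTens f.toLinearMap a ∈ symmInvTens g₀ I₀ J₀ := by
  obtain ⟨a1, a2, a3, a4⟩ := ha
  refine ⟨fun X Y Z => ?_, fun X Y Z => ?_, fun X Y Z => ?_, fun m e he X => ?_⟩ <;>
    simp only [pullTens_three, LinearEquiv.coe_coe, hI, hJ]
  · exact a1 _ _ _
  · exact a2 _ _ _
  · exact a3 _ _ _
  · have he' : IsOrthonormalBasis g (e.map f) := fun i j => by simp [hg, he i j]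
    simpa using a4 m (e.map f) he' (f X)

theorem pullTens_wedgeTail (f : V →ₗ[ℝ] W) {g₀ : V →ₗ[ℝ] V →ₗ[ℝ] ℝ} {A₀ : V →ₗ[ℝ] V}
    {g : W →ₗ[ℝ] W →ₗ[ℝ] ℝ} {A : W →ₗ[ℝ] W} (hg : ∀ X Y, g (f X) (f Y) = g₀ X Y)
    (hA : ∀ X, f (A₀ X) = A (f X)) (r : Tens W 3) :
    pullTens f (wedgeTail (kahler g A) r) = wedgeTail (kahler g₀ A₀) (pullTens f r) := by
  ext v
  rw [pullTens_apply, wedgeTail_apply, wedgeTail_apply]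
  simp only [kahler_apply, pullTens_three, ← hA, hg]

theorem pullTens_omegaDer (f : V →ₗ[ℝ] W) {g₀ : V →ₗ[ℝ] V →ₗ[ℝ] ℝ} {I₀ J₀ K₀ : V →ₗ[ℝ] V}
    {g : W →ₗ[ℝ] W →ₗ[ℝ] ℝ} {I J K : W →ₗ[ℝ] W} (hg : ∀ X Y, g (f X) (f Y) = g₀ X Y)
    (hI : ∀ X, f (I₀ X) = I (f X)) (hJ : ∀ X, f (J₀ X) = J (f X)) (hK : ∀ X, f (K₀ X) = K (f X))
    (a b c : Tens W 3) :
    pullTens f (omegaDer g I J K (a, b, c)) =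
      omegaDer g₀ I₀ J₀ K₀ (pullTens f a, pullTens f b, pullTens f c) := by
  have hadd {s : ℕ} (x y : Tens W s) : pullTens f (x + y) = pullTens f x + pullTens f y := rfl
  have hsub (x y : Tens W 3) : pullTens f (x - y) = pullTens f x - pullTens f y := rfl
  have hsmul (t : ℝ) (x : Tens W 5) : pullTens f (t • x) = t • pullTens f x := rfl
  rw [omegaDer_apply, omegaDer_apply, hsmul, hadd, hadd, pullTens_wedgeTail f hg hI,
    pullTens_wedgeTail f hg hJ, pullTens_wedgeTail f hg hK, hsub, hsub, hsub]
  simp only [slotActL_apply, pullTens_slotAct f hI, pullTens_slotAct f hJ, pullTens_slotAct f hK]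

theorem pullTens_partMap (f : V →ₗ[ℝ] W) {g₀ : V →ₗ[ℝ] V →ₗ[ℝ] ℝ} {I₀ J₀ K₀ : V →ₗ[ℝ] V}
    {g : W →ₗ[ℝ] W →ₗ[ℝ] ℝ} {I J K : W →ₗ[ℝ] W} (hg : ∀ X Y, g (f X) (f Y) = g₀ X Y)
    (hI : ∀ X, f (I₀ X) = I (f X)) (hJ : ∀ X, f (J₀ X) = J (f X)) (hK : ∀ X, f (K₀ X) = K (f X))
    (s d d' : Tens W 3) :
    pullTens f (partMapH g I J K s) = partMapH g₀ I₀ J₀ K₀ (pullTens f s) ∧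
    pullTens f (partMapS g I J K (d, d')) =
      partMapS g₀ I₀ J₀ K₀ (pullTens f d, pullTens f d') := by
  have hsmul (t : ℝ) (x : Tens W 5) : pullTens f (t • x) = t • pullTens f x := rfl
  constructor
  · rw [partMapH_apply, hsmul, pullTens_omegaDer f hg hI hJ hK, pullTens_slotAct f hI,
      pullTens_slotAct f hJ, pullTens_slotAct f hK]; rfl
  · rw [partMapS_apply, hsmul, pullTens_omegaDer f hg hI hJ hK, pullTens_slotAct f hI,
      pullTens_slotAct f hJ, pullTens_slotAct f hK]; rfl

end PullBack

/-- The converse maps must be defined on all tensors, while injectivity is known only on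
`symmInvTens`; a left inverse of the restriction is enough. -/
theorem exists_leftInverse_on {X Y : Type*} [AddCommGroup X] [Module ℝ X] [AddCommGroup Y]
    [Module ℝ Y] (L : X →ₗ[ℝ] Y) (S : Submodule ℝ X) (hL : ∀ x ∈ S, L x = 0 → x = 0) :
    ∃ N : Y →ₗ[ℝ] X, ∀ x ∈ S, N (L x) = x := by
  have hk : LinearMap.ker (L ∘ₗ S.subtype) = ⊥ :=
    LinearMap.ker_eq_bot'.2 fun x hx => Subtype.ext (hL x x.2 hx)
  obtain ⟨N, hN⟩ := LinearMap.exists_leftInverse_of_injective _ hk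
  exact ⟨S.subtype ∘ₗ N, fun x hx => congrArg Subtype.val (LinearMap.congr_fun hN ⟨x, hx⟩)⟩

/-- The linear maps of a model space which exchange the isotypic parts of the derivative of `Ω`
and the combinations of the tensors `I_(1) α_I`, `J_(1) α_J`, `K_(1) α_K`. -/
theorem exists_partMaps {V : Type*} [AddCommGroup V] [Module ℝ V] {d : ℕ} (hd : 0 < d)
    (hV : Module.finrank ℝ V = d) {g₀ : V →ₗ[ℝ] V →ₗ[ℝ] ℝ} {I₀ J₀ K₀ : V →ₗ[ℝ] V}
    (h₀ : IsQuaternionHermitian g₀ I₀ J₀ K₀) :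
    ∃ (L_H : Tens V 3 →ₗ[ℝ] Tens V 5) (M_H : Tens V 5 →ₗ[ℝ] Tens V 3)
      (L_S : Tens V 3 × Tens V 3 →ₗ[ℝ] Tens V 5) (M_S : Tens V 5 →ₗ[ℝ] Tens V 3 × Tens V 3),
      ∀ (W : Type) [AddCommGroup W] [Module ℝ W] (g : W →ₗ[ℝ] W →ₗ[ℝ] ℝ) (I J K : W →ₗ[ℝ] W),
        IsQuaternionHermitian g I J K → ∀ a ∈ symmInvTens g I J, ∀ b ∈ symmInvTens g I J,
        ∀ c ∈ symmInvTens g I J, ∀ f : V ≃ₗ[ℝ] W,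
        (∀ X Y, g (f X) (f Y) = g₀ X Y) → (∀ X, f (I₀ X) = I (f X)) →
        (∀ X, f (J₀ X) = J (f X)) → (∀ X, f (K₀ X) = K (f X)) →
        (pullTens f.toLinearMap (part I J K 1 (omegaDer g I J K (a, b, c))) =
            L_H (pullTens f.toLinearMap (slotAct I 0 a + slotAct J 0 b + slotAct K 0 c)) ∧
          pullTens f.toLinearMap (slotAct I 0 a + slotAct J 0 b + slotAct K 0 c) =
            M_H (pullTens f.toLinearMap (part I J K 1 (omegaDer g I J K (a, b, c))))) ∧
        (pullTens f.toLinearMap (part I J K 3 (omegaDer g I J K (a, b, c))) =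
            L_S (pullTens f.toLinearMap (slotAct I 0 a - slotAct J 0 b),
              pullTens f.toLinearMap (slotAct J 0 b - slotAct K 0 c)) ∧
          (pullTens f.toLinearMap (slotAct I 0 a - slotAct J 0 b),
              pullTens f.toLinearMap (slotAct J 0 b - slotAct K 0 c)) =
            M_S (pullTens f.toLinearMap (part I J K 3 (omegaDer g I J K (a, b, c))))) := by
  have : FiniteDimensional ℝ V := Module.finite_of_finrank_pos (hV ▸ hd)
  obtain ⟨e, he⟩ := h₀.exists_orthonormalBasis
  have hm : 0 < Module.finrank ℝ V := hV ▸ hd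
  obtain ⟨M_H, hMH⟩ := exists_leftInverse_on (partMapH g₀ I₀ J₀ K₀) (symmInvTens g₀ I₀ J₀)
    fun s hs h0 => partMapH_injOn h₀ hm he hs h0
  obtain ⟨M_S, hMS⟩ := exists_leftInverse_on (partMapS g₀ I₀ J₀ K₀)
    ((symmInvTens g₀ I₀ J₀).prod (symmInvTens g₀ I₀ J₀))
    fun s hs h0 => Prod.ext (partMapS_injOn h₀ hm he hs.1 hs.2 h0).1
      (partMapS_injOn h₀ hm he hs.1 hs.2 h0).2
  refine ⟨partMapH g₀ I₀ J₀ K₀, M_H, partMapS g₀ I₀ J₀ K₀, M_S, ?_⟩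
  intro W _ _ g I J K h a ha b hb c hc f hg hI hJ hK
  have mI := slotAct_zero_mem ha I
  have mJ := slotAct_zero_mem hb J
  have mK := slotAct_zero_mem hc K
  rw [(part_omegaDer h ha hb hc).1, (part_omegaDer h ha hb hc).2,
    (pullTens_partMap f.toLinearMap hg hI hJ hK _ 0 0).1,
    (pullTens_partMap f.toLinearMap hg hI hJ hK 0 _ _).2]
  have pm {x : Tens W 3} (hx : x ∈ symmInvTens g I J) :=
    pullTens_mem_symmInvTens f hg hI hJ hx
  exact ⟨⟨rfl, (hMH _ (pm (add_mem (add_mem mI mJ) mK))).symm⟩,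
    ⟨rfl, (hMS _ ⟨pm (sub_mem mI mJ), pm (sub_mem mJ mK)⟩).symm⟩⟩

/-! ### Pointwise algebra of `∇I, ∇J, ∇K` and of the tensors `α` -/

section PointwiseDerivatives

variable {V : Type*} [AddCommGroup V] [Module ℝ V]

/-- The `(0,3)`-tensor `(X, Y, Z) ↦ g (Y, D_X Z)`. -/
def kahlerDer (g : V →ₗ[ℝ] V →ₗ[ℝ] ℝ) (D : V →ₗ[ℝ] V →ₗ[ℝ] V) : Tens V 3 :=
  LinearMap.uncurryLeft
    { toFun := fun X => kahler g (D X)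
      map_add' := fun X Y => tens_two_ext fun _ _ => by simp [kahler_apply]
      map_smul' := fun c X => tens_two_ext fun _ _ => by simp [kahler_apply] }

theorem kahlerDer_apply (g : V →ₗ[ℝ] V →ₗ[ℝ] ℝ) (D : V →ₗ[ℝ] V →ₗ[ℝ] V) (X Y Z : V) :
    kahlerDer g D ![X, Y, Z] = g Y (D X Z) := rfl

/-- `DI, DJ, DK` are infinitesimal variations of `I, J, K` within the `g`-orthogonal quaternionic
bases. -/
structure IsQuaternionicVariation (g : V →ₗ[ℝ] V →ₗ[ℝ] ℝ) (I J K : V →ₗ[ℝ] V)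
    (DI DJ DK : V →ₗ[ℝ] V →ₗ[ℝ] V) : Prop where
  sq_I : ∀ X Z, DI X (I Z) = -I (DI X Z)
  sq_J : ∀ X Z, DJ X (J Z) = -J (DJ X Z)
  sq_K : ∀ X Z, DK X (K Z) = -K (DK X Z)
  mul_I : ∀ X Z, DI X Z = DJ X (K Z) + J (DK X Z)
  mul_J : ∀ X Z, DJ X Z = DK X (I Z) + K (DI X Z)
  mul_K : ∀ X Z, DK X Z = DI X (J Z) + I (DJ X Z)
  skew_I : ∀ X Y Z, g (DI X Y) Z = -g Y (DI X Z)
  skew_J : ∀ X Y Z, g (DJ X Y) Z = -g Y (DJ X Z)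
  skew_K : ∀ X Y Z, g (DK X Y) Z = -g Y (DK X Z)

theorem IsQuaternionicVariation.cycle {g : V →ₗ[ℝ] V →ₗ[ℝ] ℝ} {I J K : V →ₗ[ℝ] V}
    {DI DJ DK : V →ₗ[ℝ] V →ₗ[ℝ] V} (hD : IsQuaternionicVariation g I J K DI DJ DK) :
    IsQuaternionicVariation g J K I DJ DK DI :=
  ⟨hD.sq_J, hD.sq_K, hD.sq_I, hD.mul_J, hD.mul_K, hD.mul_I, hD.skew_J, hD.skew_K, hD.skew_I⟩

/-- The one-form `X ↦ ⟨g (·, D_X ·), ω_K⟩ / d`. -/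
def lamForm (d : ℝ) (g : V →ₗ[ℝ] V →ₗ[ℝ] ℝ) (K : V →ₗ[ℝ] V) (D : V →ₗ[ℝ] V →ₗ[ℝ] V) : V →ₗ[ℝ] ℝ :=
  (1 / d) • innerForm g (kahlerDer g D) (kahler g K)

/-- The tensor `-λ ⊗ g + ½ (J_(2) - J_(3)) g (·, DK ·)`. -/
def alphaTens (d : ℝ) (g : V →ₗ[ℝ] V →ₗ[ℝ] ℝ) (J K : V →ₗ[ℝ] V) (DJ DK : V →ₗ[ℝ] V →ₗ[ℝ] V) :
    Tens V 3 :=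
  -(tmul (ofLin (lamForm d g K DJ)) (ofBilin g) : Tens V (1 + 2))
    + (1 / 2 : ℝ) • (slotAct J 1 (kahlerDer g DK) - slotAct J 2 (kahlerDer g DK))

theorem alphaTens_apply (d : ℝ) (g : V →ₗ[ℝ] V →ₗ[ℝ] ℝ) (J K : V →ₗ[ℝ] V)
    (DJ DK : V →ₗ[ℝ] V →ₗ[ℝ] V) (X Y Z : V) :
    alphaTens d g J K DJ DK ![X, Y, Z] = -(lamForm d g K DJ X * g Y Z)
      + 1 / 2 * (-g (J Y) (DK X Z) + g Y (DK X (J Z))) := by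
  have h1 : (tmul (ofLin (lamForm d g K DJ)) (ofBilin g) : Tens V (1 + 2)) ![X, Y, Z] =
      lamForm d g K DJ X * g Y Z := rfl
  have h2 : (slotAct J 1 (kahlerDer g DK) - slotAct J 2 (kahlerDer g DK)) ![X, Y, Z] =
      -g (J Y) (DK X Z) + g Y (DK X (J Z)) := by
    rw [sub_apply, slotAct_one_three, slotAct_two_three, kahlerDer_apply, kahlerDer_apply,
      sub_neg_eq_add]
  rw [← h1, ← h2]; rfl

theorem innerTwo_eq_sum {g : V →ₗ[ℝ] V →ₗ[ℝ] ℝ} {I J K : V →ₗ[ℝ] V}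
    (h : IsQuaternionHermitian g I J K) [FiniteDimensional ℝ V] :
    ∃ e : Module.Basis (Fin (Module.finrank ℝ V)) ℝ V, IsOrthonormalBasis g e ∧
      ∀ a b : Tens V 2, innerTwo g a b = ∑ i, ∑ j, a ![e i, e j] * b ![e i, e j] := by
  obtain he := h.exists_orthonormalBasis
  exact ⟨he.choose, he.choose_spec, fun a b => dif_pos he⟩

theorem lamForm_apply {g : V →ₗ[ℝ] V →ₗ[ℝ] ℝ} {I J K : V →ₗ[ℝ] V}
    (h : IsQuaternionHermitian g I J K) [FiniteDimensional ℝ V] :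
    ∃ e : Module.Basis (Fin (Module.finrank ℝ V)) ℝ V, IsOrthonormalBasis g e ∧
      ∀ (d : ℝ) (D : V →ₗ[ℝ] V →ₗ[ℝ] V) (X : V),
        lamForm d g K D X = 1 / d * ∑ j, g (D X (e j)) (K (e j)) := by
  obtain ⟨e, he, hsum⟩ := innerTwo_eq_sum h
  refine ⟨e, he, fun d D X => ?_⟩
  have h1 : lamForm d g K D X =
      1 / d * innerTwo g ((kahlerDer g D).curryLeft X) (kahler g K) := rfl
  have h2 (i j) : (kahlerDer g D).curryLeft X ![e i, e j] = g (e i) (D X (e j)) := rfl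
  rw [h1, hsum, Finset.sum_comm]
  congr 1
  refine Finset.sum_congr rfl fun j _ => ?_
  simp only [h2, kahler_apply]
  have := he.sum_mul (g (D X (e j))) (K (e j))
  rw [← this]
  refine Finset.sum_congr rfl fun i _ => ?_
  rw [h.symm (e i) (D X (e j)), mul_comm]

/-- Antisymmetrizing the action of `J` over the last two slots makes the skew tensor `∇ω_K`
symmetric and `J`-invariant. Invariance under `K` holds because `∇_X K` anticommutes with `K`, and
`λ_I ⊗ g` removes the trace. -/
theorem alphaTens_mem {g : V →ₗ[ℝ] V →ₗ[ℝ] ℝ} {I J K : V →ₗ[ℝ] V}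
    (h : IsQuaternionHermitian g I J K) {DI DJ DK : V →ₗ[ℝ] V →ₗ[ℝ] V}
    (hD : IsQuaternionicVariation g I J K DI DJ DK) {d : ℕ} (hd : 0 < d)
    (hV : Module.finrank ℝ V = d) :
    alphaTens d g J K DJ DK ∈ symmInvTens g I J := by
  have : FiniteDimensional ℝ V := Module.finite_of_finrank_pos (hV ▸ hd)
  have hKI (X Z) : DK X (I Z) = K (DK X (J Z)) := by
    have := hD.sq_K X (J Z)
    rw [(h.mul_table Z).2.2.2.2.2.2.2.1, map_neg] at this
    exact neg_injective this
  have key : alphaTens d g J K DJ DK ∈ symmInvTens g J K := by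
    refine ⟨fun X Y Z => ?_, fun X Y Z => ?_, fun X Y Z => ?_, fun m e he X => ?_⟩
    · rw [alphaTens_apply, alphaTens_apply, h.symm Z Y]
      have h1 := hD.skew_K X (J Y) Z
      have h2 := hD.skew_K X (J Z) Y
      rw [h.symm Z (DK X (J Y)), h.symm Y (DK X (J Z)), h1, h2]; ring
    · rw [alphaTens_apply, alphaTens_apply, (h.skew Y Z).2.1]
      simp only [h.mul_table, map_neg, LinearMap.neg_apply, (h.skew _ _).2.1]
      ring
    · rw [alphaTens_apply, alphaTens_apply, (h.skew Y Z).2.2]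
      simp only [h.mul_table, map_neg, (h.skew _ _).2.1, (h.skew _ _).1,
        (h.skew _ _).2.2, hD.sq_K, hKI]
      ring
    · have hz (Y) : g (DI X Y) Y = 0 := by
        have := hD.skew_I X Y Y
        rw [h.symm Y] at this; linarith
      -- The derivative of the pointwise identity `g (JY, KY) = 0`; it matches `λ_I`, defined by
      -- `∇ω_J`, with the trace of the `∇ω_K`-term.
      have hpt (Y) : g (DJ X Y) (K Y) = -g (J Y) (DK X Y) := by
        rw [hD.mul_J, hKI, map_add, LinearMap.add_apply, h.K_orth, h.K_orth, hz, add_zero,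
          hD.skew_K]
      -- `λ_I` is computed in the basis chosen inside `innerTwo`, so the trace is moved to that
      -- basis.
      obtain ⟨e', he', hlam⟩ := lamForm_apply h
      have hb := he.trace_eq h.symm he' (lastTwo (alphaTens d g J K DJ DK) X)
      simp only [lastTwo_apply] at hb
      rw [hb]
      have hone (i) : g (e' i) (e' i) = 1 := by simp [he' i i]
      simp only [alphaTens_apply, hone, hlam, hpt]
      have h2 (i) : g (e' i) (DK X (J (e' i))) = -g (J (e' i)) (DK X (e' i)) := by
        rw [h.symm, hD.skew_K]
      simp only [h2, Finset.sum_add_distrib, Finset.sum_neg_distrib, Finset.sum_const,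
        Finset.card_univ, Fintype.card_fin, nsmul_eq_mul, ← Finset.mul_sum, hV]
      have : (d : ℝ) ≠ 0 := by positivity
      field_simp
      ring
  exact symmInvTens_cycle h.cycle.cycle (symmInvTens_cycle h.cycle key)

/-- Recovers `∇ω_I` from `α_J` and `α_K`, up to the terms `-λ_K ⊗ ω_J + λ_J ⊗ ω_K`. -/
theorem slotAct_alphaTens_sub {g : V →ₗ[ℝ] V →ₗ[ℝ] ℝ} {I J K : V →ₗ[ℝ] V}
    (h : IsQuaternionHermitian g I J K) {DI DJ DK : V →ₗ[ℝ] V →ₗ[ℝ] V}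
    (hD : IsQuaternionicVariation g I J K DI DJ DK) (d : ℝ) (X Y Z : V) :
    (slotAct J 1 (alphaTens d g I J DI DJ) - slotAct K 1 (alphaTens d g K I DK DI)) ![X, Y, Z] =
      g Y (DI X Z) - lamForm d g J DI X * g Y (J Z) + lamForm d g I DK X * g Y (K Z) := by
  -- This is the derivative of `I = JK` with `∇K` replaced by the derivative of `K = IJ`, rewritten
  -- with the anticommutation of `∇I` with `I` and of `∇J` with `J`.
  have key : J (DJ X (I Z)) - K (DJ X Z) - K (DI X (K Z)) = DI X Z := by
    have e1 : DJ X (J (I Z)) = -J (DJ X (I Z)) := hD.sq_J X (I Z)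
    rw [(h.mul_table Z).2.2.2.2.2.2.1, map_neg] at e1
    have e2 := hD.mul_I X Z
    have e3 := congrArg J (hD.mul_K X Z)
    rw [map_add, (h.mul_table (DJ X Z)).2.2.2.2.2.2.1] at e3
    have e4 : K (DI X (K Z)) = -J (DI X (J Z)) := by
      rw [h.K_eq Z, hD.sq_I, map_neg, (h.mul_table _).2.2.2.2.2.1]
    rw [e4, ← neg_injective e1, e2, e3]
    abel
  have key' := congrArg (g Y) key
  simp only [map_sub] at key'
  rw [sub_apply, slotAct_one_three, slotAct_one_three, alphaTens_apply, alphaTens_apply]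
  simp only [h.mul_table, map_neg, LinearMap.neg_apply, (h.skew _ _).2.1,
    (h.skew _ _).2.2] at key' ⊢
  linarith

/-- The `λ`-terms cancel in pairs: for instance `λ_K ⊗ ω_I ∧ ω_J` arises from the `ω_I`- and
`ω_J`-terms with opposite signs. -/
theorem omegaDer_alphaTens {g : V →ₗ[ℝ] V →ₗ[ℝ] ℝ} {I J K : V →ₗ[ℝ] V}
    (h : IsQuaternionHermitian g I J K) {DI DJ DK : V →ₗ[ℝ] V →ₗ[ℝ] V}
    (hD : IsQuaternionicVariation g I J K DI DJ DK) (d : ℝ) :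
    omegaDer g I J K (alphaTens d g J K DJ DK, alphaTens d g K I DK DI, alphaTens d g I J DI DJ) =
      (2 : ℝ) • wedgeTail (kahler g I) (kahlerDer g DI)
        + (2 : ℝ) • wedgeTail (kahler g J) (kahlerDer g DJ)
        + (2 : ℝ) • wedgeTail (kahler g K) (kahlerDer g DK) := by
  rw [omegaDer_apply]
  simp only [slotActL_apply]
  ext v
  simp only [smul_apply, add_apply, wedgeTail_apply, slotAct_alphaTens_sub h hD,
    slotAct_alphaTens_sub h.cycle hD.cycle, slotAct_alphaTens_sub h.cycle.cycle hD.cycle.cycle,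
    kahlerDer_apply, kahler_apply, smul_eq_mul]
  ring

end PointwiseDerivatives

/-! ### Covariant derivatives of endomorphism fields -/

section EndomorphismDerivatives

variable {E : Type*} [NormedAddCommGroup E] [NormedSpace ℝ E]
  {H : Type*} [TopologicalSpace H] {IM : ModelWithCorners ℝ E H}
  {M : Type*} [TopologicalSpace M] [ChartedSpace H M]

theorem mvfderiv_congr_of_eventuallyEq {f f' : M → ℝ} {x : M} (h : f =ᶠ[nhds x] f') :
    mvfderiv IM f x = mvfderiv IM f' x := by
  simp only [mvfderiv, h.mfderiv_eq]
  rfl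

variable [IsManifold IM ∞ M]
  {nabla : CovariantDerivative IM E (fun x : M => TangentSpace IM x)}

/-- The vector field `V` is differentiable at `x`. -/
def VecDiffAt (V : ∀ y : M, TangentSpace IM y) (x : M) : Prop :=
  MDifferentiableAt IM (IM.prod 𝓘(ℝ, E)) (fun y => (⟨y, V y⟩ : TangentBundle IM M)) x

/-- `D` is the covariant derivative at `x` of the endomorphism field `A`. -/
def HasEndDerivAt (nabla : CovariantDerivative IM E (fun x : M => TangentSpace IM x))
    (A : EndField IM M) (x : M)
    (D : TangentSpace IM x →ₗ[ℝ] TangentSpace IM x →ₗ[ℝ] TangentSpace IM x) : Prop :=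
  ∀ Z : ∀ y : M, TangentSpace IM y, VecDiffAt Z x → VecDiffAt (fun y => A y (Z y)) x ∧
    ∀ X, D X (Z x) = nabla (fun y => A y (Z y)) x X - A x (nabla Z x X)

variable (IM M) in
theorem isManifold_two : IsManifold IM (1 + 1) M :=
  IsManifold.of_le (n := ∞) (by norm_cast)

theorem exists_vecDiffAt {x : M} (X : TangentSpace IM x) :
    ∃ V : ∀ y : M, TangentSpace IM y, VecDiffAt V x ∧ V x = X := by
  have := isManifold_two IM M
  exact ⟨FiberBundle.extend E X, FiberBundle.mdifferentiableAt_extend .., by simp⟩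

/-- Makes differentiation of `A² = -1` an instance of `HasEndDerivAt.comp`. -/
theorem hasEndDerivAt_neg_id {x : M} :
    HasEndDerivAt nabla (fun y => -ContinuousLinearMap.id ℝ (TangentSpace IM y)) x 0 := by
  intro V hV
  have e : (fun y => (-ContinuousLinearMap.id ℝ (TangentSpace IM y)) (V y)) = (-1 : ℝ) • V := by
    funext y; simp
  have hd : VecDiffAt ((-1 : ℝ) • V) x := by
    have := mdifferentiableAt_const (I := IM) (I' := 𝓘(ℝ, ℝ)) (x := x)
      (c := (-1 : ℝ)) |>.smul_section hV
    exact this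
  rw [e]
  refine ⟨hd, fun X => ?_⟩
  rw [nabla.isCovariantDerivativeOn.smul_const _ hV]
  simp

variable {g : Bundle.ContMDiffRiemannianMetric IM ∞ E (fun x : M => TangentSpace IM x)}

theorem HasEndDerivAt.comp {A B C : EndField IM M} {U : Set M} (hU : IsOpen U) {x : M}
    (hx : x ∈ U) (hC : ∀ y ∈ U, ∀ Z, C y Z = A y (B y Z))
    {DA DB DC : TangentSpace IM x →ₗ[ℝ] TangentSpace IM x →ₗ[ℝ] TangentSpace IM x}
    (hDA : HasEndDerivAt nabla A x DA) (hDB : HasEndDerivAt nabla B x DB)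
    (hDC : HasEndDerivAt nabla C x DC) (X Z : TangentSpace IM x) :
    DC X Z = DA X (B x Z) + A x (DB X Z) := by
  obtain ⟨V, hV, rfl⟩ := exists_vecDiffAt Z
  have hB := hDB V hV
  have hA := hDA _ hB.1
  have hC' := hDC V hV
  have e := nabla.isCovariantDerivativeOn.congr_of_eventuallyEq hC'.1 hA.1 Filter.univ_mem
    (Filter.eventually_of_mem (hU.mem_nhds hx) fun y hy => hC y hy (V y))
  rw [hC'.2, hA.2, hB.2, map_sub, e, hC x hx]
  abel

theorem HasEndDerivAt.sq_neg {A : EndField IM M} {U : Set M} (hU : IsOpen U) {x : M}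
    (hx : x ∈ U) (hA : ∀ y ∈ U, ∀ Z, A y (A y Z) = -Z)
    {D : TangentSpace IM x →ₗ[ℝ] TangentSpace IM x →ₗ[ℝ] TangentSpace IM x}
    (hD : HasEndDerivAt nabla A x D) (X Z : TangentSpace IM x) :
    D X (A x Z) = -A x (D X Z) := by
  have := HasEndDerivAt.comp hU hx (fun y hy Z => by simp [hA y hy Z]) hD hD
    (hasEndDerivAt_neg_id (x := x)) X Z
  exact eq_neg_of_add_eq_zero_left this.symm

theorem mdifferentiableAt_metric {x : M} {V W : ∀ y : M, TangentSpace IM y} (hV : VecDiffAt V x)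
    (hW : VecDiffAt W x) :
    MDifferentiableAt IM 𝓘(ℝ, ℝ) (fun y => g.inner y (V y) (W y)) x := by
  have h : MDifferentiableAt IM (IM.prod 𝓘(ℝ, ℝ))
      (fun y => Bundle.TotalSpace.mk' ℝ (E := Bundle.Trivial M ℝ) y (g.inner y (V y) (W y))) x := by
    apply MDifferentiableAt.clm_bundle_apply₂ (F₁ := E) (F₂ := E)
    · exact g.contMDiff.contMDiffAt.mdifferentiableAt (by simp)
    · exact hV
    · exact hW
  rw [mdifferentiableAt_totalSpace] at h
  exact h.2

variable [FiniteDimensional ℝ E]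

/-- In `∇(AZ) - A ∇Z` the derivative terms of the Leibniz rule cancel, so the expression is
tensorial in `Z`. -/
theorem exists_hasEndDerivAt {A : EndField IM M} {U : Set M} (hU : IsOpen U)
    (hA : SmoothEndOn A U) {x : M} (hx : x ∈ U) : ∃ D, HasEndDerivAt nabla A x D := by
  have := isManifold_two IM M
  have hA' := (hA.contMDiffAt (hU.mem_nhds hx)).mdifferentiableAt (by simp)
  have hdiff (Z : ∀ y : M, TangentSpace IM y) (hZ : VecDiffAt Z x) :
      VecDiffAt (fun y => A y (Z y)) x := hA'.clm_bundle_apply hZ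
  let Φ (Z : ∀ y : M, TangentSpace IM y) : TangentSpace IM x →L[ℝ] TangentSpace IM x :=
    nabla (fun y => A y (Z y)) x - (A x).comp (nabla Z x)
  have hΦ : TensorialAt IM E Φ x := by
    constructor
    · intro f Z hf hZ
      have e : (fun y => A y ((f • Z) y)) = f • fun y => A y (Z y) := by
        funext y; exact (A y).map_smul _ _
      simp only [Φ]
      rw [e, nabla.isCovariantDerivativeOn.leibniz (hdiff Z hZ) hf,
        nabla.isCovariantDerivativeOn.leibniz hZ hf]
      ext X
      simp [smul_sub]
    · intro Z Z' hZ hZ'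
      have e : (fun y => A y ((Z + Z') y)) = (fun y => A y (Z y)) + fun y => A y (Z' y) := by
        funext y; exact (A y).map_add _ _
      simp only [Φ]
      rw [e, nabla.isCovariantDerivativeOn.add (hdiff Z hZ) (hdiff Z' hZ'),
        nabla.isCovariantDerivativeOn.add hZ hZ']
      ext X
      simp
      abel
  refine ⟨LinearMap.mk₂ ℝ (fun X Z => TensorialAt.mkHom Φ x hΦ Z X) (by simp) (by simp) (by simp)
    (by simp), fun Z hZ => ⟨hdiff Z hZ, fun X => ?_⟩⟩
  rw [LinearMap.mk₂_apply, TensorialAt.mkHom_apply hΦ hZ]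
  rfl

/-- Differentiate `g (AV, W) = -g (V, AW)` and use `∇g = 0`. -/
theorem HasEndDerivAt.skew (hg : IsLeviCivita g nabla) {A : EndField IM M} {U : Set M}
    (hU : IsOpen U) {x : M} (hx : x ∈ U)
    (hA : ∀ y ∈ U, ∀ X Y, metricAt g y (A y X) Y = -metricAt g y X (A y Y))
    {D : TangentSpace IM x →ₗ[ℝ] TangentSpace IM x →ₗ[ℝ] TangentSpace IM x}
    (hD : HasEndDerivAt nabla A x D) (X Y Z : TangentSpace IM x) :
    metricAt g x (D X Y) Z = -metricAt g x Y (D X Z) := by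
  obtain ⟨V, hV, rfl⟩ := exists_vecDiffAt Y
  obtain ⟨W, hW, rfl⟩ := exists_vecDiffAt Z
  have hAV := hD V hV
  have hAW := hD W hW
  have h1 := hg.metric x _ _ hAV.1 hW X
  have h2 := hg.metric x _ _ hV hAW.1 X
  have e : (fun y => g.inner y (A y (V y)) (W y)) =ᶠ[nhds x]
      fun y => -g.inner y (V y) (A y (W y)) :=
    Filter.eventually_of_mem (hU.mem_nhds hx) fun y hy => hA y hy (V y) (W y)
  rw [mvfderiv_congr_of_eventuallyEq e, mvfderiv_fun_neg, neg_apply, h2] at h1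
  have h3 := hA x hx (V x) (nabla W x X)
  have h4 := hA x hx (nabla V x X) (W x)
  rw [hAV.2, hAW.2, map_sub, map_sub, LinearMap.sub_apply]
  change g.inner x _ _ = - g.inner x _ _ at h3 h4
  change g.inner x _ _ - g.inner x _ _ = -(g.inner x _ _ - g.inner x _ _)
  linarith

end EndomorphismDerivatives

/-! ### Covariant derivatives of tensor fields -/

section TensorDerivatives

variable {E : Type*} [NormedAddCommGroup E] [NormedSpace ℝ E]
  {H : Type*} [TopologicalSpace H] {IM : ModelWithCorners ℝ E H}
  {M : Type*} [TopologicalSpace M] [ChartedSpace H M] [IsManifold IM ∞ M]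
  {nabla : CovariantDerivative IM E (fun x : M => TangentSpace IM x)}
  {g : Bundle.ContMDiffRiemannianMetric IM ∞ E (fun x : M => TangentSpace IM x)} {x : M}

/-- Every tangent vector extends to a field differentiable at `x`, so the defining formula
determines the derivative and the choice in `covDeriv` is harmless. -/
theorem HasCovDerivAt.covDeriv_eq {s : ℕ} {T : ∀ x : M, Tens (TangentSpace IM x) s}
    {D : Tens (TangentSpace IM x) (s + 1)} (hD : HasCovDerivAt nabla T x D) :
    covDeriv nabla T x = D := by
  have h : ∃ D, HasCovDerivAt nabla T x D := ⟨D, hD⟩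
  have hc : covDeriv nabla T x = h.choose := dif_pos h
  rw [hc]
  ext v
  choose V hV hVv using fun i : Fin s => exists_vecDiffAt (v i.succ)
  have e : v = Fin.cons (v 0) fun i => V i x := by
    rw [funext hVv]; exact (Fin.cons_self_tail v).symm
  rw [e, (h.choose_spec V hV).2, (hD V hV).2]

theorem HasCovDerivAt.add {s : ℕ} {T T' : ∀ x : M, Tens (TangentSpace IM x) s}
    {D D' : Tens (TangentSpace IM x) (s + 1)} (hD : HasCovDerivAt nabla T x D)
    (hD' : HasCovDerivAt nabla T' x D') :
    HasCovDerivAt nabla (fun y => T y + T' y) x (D + D') := by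
  intro V hV
  obtain ⟨h1, h2⟩ := hD V hV
  obtain ⟨h1', h2'⟩ := hD' V hV
  refine ⟨h1.add h1', fun X => ?_⟩
  simp only [add_apply, h2, h2']
  rw [mvfderiv_fun_add h1 h1', add_apply, Finset.sum_add_distrib]
  ring

theorem HasCovDerivAt.two {w : ∀ x : M, Tens (TangentSpace IM x) 2}
    {D : Tens (TangentSpace IM x) 3} (hD : HasCovDerivAt nabla w x D)
    {V W : ∀ y : M, TangentSpace IM y} (hV : VecDiffAt V x) (hW : VecDiffAt W x) :
    MDifferentiableAt IM 𝓘(ℝ, ℝ) (fun y => w y ![V y, W y]) x ∧ ∀ X : TangentSpace IM x,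
      mvfderiv IM (fun y => w y ![V y, W y]) x X = D ![X, V x, W x]
        + w x ![nabla V x X, W x] + w x ![V x, nabla W x X] := by
  have h := hD ![V, W] (by intro i; fin_cases i; exacts [hV, hW])
  have e (y : M) : (fun i => (![V, W] : Fin 2 → ∀ y : M, TangentSpace IM y) i y) =
      ![V y, W y] := by
    funext i; fin_cases i <;> rfl
  simp only [e, Fin.sum_univ_two] at h
  refine ⟨h.1, fun X => ?_⟩
  have h2 := h.2 X
  have e0 (Z : TangentSpace IM x) : Function.update ![V x, W x] 0 Z = ![Z, W x] := by
    funext i; fin_cases i <;> rfl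
  have e1 (Z : TangentSpace IM x) : Function.update ![V x, W x] 1 Z = ![V x, Z] := by
    funext i; fin_cases i <;> rfl
  rw [e0, e1] at h2
  change D ![X, V x, W x] = _ - (w x ![nabla V x X, W x] + w x ![V x, nabla W x X]) at h2
  rw [h2]
  ring

theorem HasCovDerivAt.mul_two {w : ∀ x : M, Tens (TangentSpace IM x) 2}
    {D : Tens (TangentSpace IM x) 3} (hD : HasCovDerivAt nabla w x D)
    {V₁ V₂ V₃ V₄ : ∀ y : M, TangentSpace IM y} (h₁ : VecDiffAt V₁ x) (h₂ : VecDiffAt V₂ x)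
    (h₃ : VecDiffAt V₃ x) (h₄ : VecDiffAt V₄ x) :
    MDifferentiableAt IM 𝓘(ℝ, ℝ) (fun y => w y ![V₁ y, V₂ y] * w y ![V₃ y, V₄ y]) x ∧
      ∀ X : TangentSpace IM x,
      mvfderiv IM (fun y => w y ![V₁ y, V₂ y] * w y ![V₃ y, V₄ y]) x X =
        (D ![X, V₁ x, V₂ x] + w x ![nabla V₁ x X, V₂ x] + w x ![V₁ x, nabla V₂ x X])
            * w x ![V₃ x, V₄ x]
          + w x ![V₁ x, V₂ x]
            * (D ![X, V₃ x, V₄ x] + w x ![nabla V₃ x X, V₄ x] + w x ![V₃ x, nabla V₄ x X]) := by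
  have h := hD.two h₁ h₂
  have h' := hD.two h₃ h₄
  refine ⟨h.1.mul h'.1, fun X => ?_⟩
  rw [mvfderiv_fun_mul h.1 h'.1, add_apply, smul_apply, smul_apply, h.2, h'.2, smul_eq_mul,
    smul_eq_mul]
  ring

/-- The product rule applied to the six shuffle terms: the terms with `∇V_i` cancel against the
correction terms, and the symmetry of the wedge product gives the factor `2`. -/
theorem HasCovDerivAt.wedgeTwo_self {w : ∀ x : M, Tens (TangentSpace IM x) 2}
    {D : Tens (TangentSpace IM x) 3} (hD : HasCovDerivAt nabla w x D) :
    HasCovDerivAt nabla (fun y => wedgeTwo (w y) (w y)) x ((2 : ℝ) • wedgeTail (w x) D) := by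
  intro V hV
  have p (i j k l : Fin 4) := hD.mul_two (hV i) (hV j) (hV k) (hV l)
  have d1 := (p 0 1 2 3).1
  have d2 := (p 0 2 1 3).1
  have d3 := (p 0 3 1 2).1
  have d4 := (p 1 2 0 3).1
  have d5 := (p 1 3 0 2).1
  have d6 := (p 2 3 0 1).1
  have e : (fun y => wedgeTwo (w y) (w y) fun i => V i y) = (((((
      (fun y => w y ![V 0 y, V 1 y] * w y ![V 2 y, V 3 y])
        - fun y => w y ![V 0 y, V 2 y] * w y ![V 1 y, V 3 y])
        + fun y => w y ![V 0 y, V 3 y] * w y ![V 1 y, V 2 y])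
        + fun y => w y ![V 1 y, V 2 y] * w y ![V 0 y, V 3 y])
        - fun y => w y ![V 1 y, V 3 y] * w y ![V 0 y, V 2 y])
        + fun y => w y ![V 2 y, V 3 y] * w y ![V 0 y, V 1 y]) :=
    funext fun y => wedgeTwo_apply _ _ _
  rw [e]
  refine ⟨((((d1.sub d2).add d3).add d4).sub d5).add d6, fun X => ?_⟩
  have hw : wedgeTail (w x) D (Fin.cons X fun i => V i x) =
      w x ![V 0 x, V 1 x] * D ![X, V 2 x, V 3 x] - w x ![V 0 x, V 2 x] * D ![X, V 1 x, V 3 x]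
        + w x ![V 0 x, V 3 x] * D ![X, V 1 x, V 2 x] + w x ![V 1 x, V 2 x] * D ![X, V 0 x, V 3 x]
        - w x ![V 1 x, V 3 x] * D ![X, V 0 x, V 2 x]
        + w x ![V 2 x, V 3 x] * D ![X, V 0 x, V 1 x] := wedgeTail_apply _ _ _
  rw [mvfderiv_add ((((d1.sub d2).add d3).add d4).sub d5) d6,
    mvfderiv_sub (((d1.sub d2).add d3).add d4) d5, mvfderiv_add ((d1.sub d2).add d3) d4,
    mvfderiv_add (d1.sub d2) d3, mvfderiv_sub d1 d2]
  simp only [_root_.add_apply, _root_.sub_apply, (p _ _ _ _).2, smul_apply, hw, smul_eq_mul,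
    Fin.sum_univ_four, wedgeTwo_apply, Function.update_apply]
  simp only [Fin.reduceEq, if_true, if_false]
  ring

variable [FiniteDimensional ℝ E]

/-- As `∇g = 0`, only the derivative of `A` survives. -/
theorem hasCovDerivAt_kahler (hg : IsLeviCivita g nabla) {A : EndField IM M}
    {D : TangentSpace IM x →ₗ[ℝ] TangentSpace IM x →ₗ[ℝ] TangentSpace IM x}
    (hD : HasEndDerivAt nabla A x D) :
    HasCovDerivAt nabla (fun y => kahler (metricAt g y) (A y).toLinearMap) x
      (kahlerDer (metricAt g x) D) := by
  intro V hV
  have h1 := hD (V 1) (hV 1)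
  refine ⟨mdifferentiableAt_metric (hV 0) h1.1, fun X => ?_⟩
  have h2 := hg.metric x _ _ (hV 0) h1.1 X
  have e : mvfderiv IM (fun y => kahler (metricAt g y) (A y).toLinearMap fun i => V i y) x X =
      _ := h2
  rw [e, Fin.sum_univ_two]
  change g.inner x (V 0 x) (D X (V 1 x)) = _ + _ -
    (g.inner x (nabla (V 0) x X) (A x (V 1 x)) + g.inner x (V 0 x) (A x (nabla (V 1) x X)))
  rw [h1.2, map_sub]
  ring

end TensorDerivatives

/-! ### From adapted bases on the manifold to the pointwise algebra -/

section AdaptedBases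

variable {E : Type*} [NormedAddCommGroup E] [NormedSpace ℝ E] [FiniteDimensional ℝ E]
  {H : Type*} [TopologicalSpace H] {IM : ModelWithCorners ℝ E H}
  {M : Type*} [TopologicalSpace M] [ChartedSpace H M] [IsManifold IM ∞ M]
  {nabla : CovariantDerivative IM E (fun x : M => TangentSpace IM x)}
  {g : Bundle.ContMDiffRiemannianMetric IM ∞ E (fun x : M => TangentSpace IM x)}
  {G : ∀ x : M, Submodule ℝ (TangentSpace IM x →L[ℝ] TangentSpace IM x)}
  {U : Set M} {I J K : EndField IM M}

/-- The relations `A² = -1`, `I = JK`, `J = KI`, `K = IJ` and the skewness of `I, J, K` hold on an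
open set, hence can be differentiated. -/
theorem IsAdaptedBasisOn.exists_variation (hg : IsLeviCivita g nabla) (hU : IsOpen U)
    (h : IsAdaptedBasisOn g G U I J K) {x : M} (hx : x ∈ U) :
    ∃ DI DJ DK, HasEndDerivAt nabla I x DI ∧ HasEndDerivAt nabla J x DJ ∧
      HasEndDerivAt nabla K x DK ∧ IsQuaternionicVariation (metricAt g x) (I x).toLinearMap
        (J x).toLinearMap (K x).toLinearMap DI DJ DK := by
  obtain ⟨DI, hI⟩ := exists_hasEndDerivAt (nabla := nabla) hU h.smooth_I hx
  obtain ⟨DJ, hJ⟩ := exists_hasEndDerivAt (nabla := nabla) hU h.smooth_J hx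
  obtain ⟨DK, hK⟩ := exists_hasEndDerivAt (nabla := nabla) hU h.smooth_K hx
  have s (y) (hy : y ∈ U) := (h.hermitian y hy).skew
  refine ⟨DI, DJ, DK, hI, hJ, hK, ?_⟩
  constructor
  · exact hI.sq_neg hU hx fun y hy => (h.hermitian y hy).I_sq
  · exact hJ.sq_neg hU hx fun y hy => (h.hermitian y hy).J_sq
  · exact hK.sq_neg hU hx fun y hy => (h.hermitian y hy).cycle.J_sq
  · exact hJ.comp hU hx (fun y hy => (h.hermitian y hy).cycle.K_eq) hK hI
  · exact hK.comp hU hx (fun y hy => (h.hermitian y hy).cycle.cycle.K_eq) hI hJ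
  · exact hI.comp hU hx (fun y hy => (h.hermitian y hy).K_eq) hJ hK
  · exact hI.skew hg hU hx fun y hy X Y => (s y hy X Y).1
  · exact hJ.skew hg hU hx fun y hy X Y => (s y hy X Y).2.1
  · exact hK.skew hg hU hx fun y hy X Y => (s y hy X Y).2.2

theorem nablaKahler_eq (hg : IsLeviCivita g nabla) {A : EndField IM M} {x : M}
    {D : TangentSpace IM x →ₗ[ℝ] TangentSpace IM x →ₗ[ℝ] TangentSpace IM x}
    (hD : HasEndDerivAt nabla A x D) :
    nablaKahler g nabla A x = kahlerDer (metricAt g x) D :=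
  (hasCovDerivAt_kahler hg hD).covDeriv_eq

theorem alpha_eq (hg : IsLeviCivita g nabla) {x : M}
    {DJ DK : TangentSpace IM x →ₗ[ℝ] TangentSpace IM x →ₗ[ℝ] TangentSpace IM x}
    (hJ : HasEndDerivAt nabla J x DJ) (hK : HasEndDerivAt nabla K x DK) :
    alpha g nabla J K x = alphaTens (Module.finrank ℝ E) (metricAt g x) (J x).toLinearMap
      (K x).toLinearMap DJ DK := by
  rw [alpha, lam, nablaKahler_eq hg hJ, nablaKahler_eq hg hK]
  rfl

theorem nablaOmega_eq (hg : IsLeviCivita g nabla) {x : M}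
    {DI DJ DK : TangentSpace IM x →ₗ[ℝ] TangentSpace IM x →ₗ[ℝ] TangentSpace IM x}
    (hI : HasEndDerivAt nabla I x DI) (hJ : HasEndDerivAt nabla J x DJ)
    (hK : HasEndDerivAt nabla K x DK)
    (h : IsQuaternionHermitian (metricAt g x) (I x).toLinearMap (J x).toLinearMap
      (K x).toLinearMap)
    (hD : IsQuaternionicVariation (metricAt g x) (I x).toLinearMap (J x).toLinearMap
      (K x).toLinearMap DI DJ DK) :
    nablaOmega g nabla I J K x = omegaDer (metricAt g x) (I x).toLinearMap (J x).toLinearMap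
      (K x).toLinearMap (alpha g nabla J K x, alpha g nabla K I x, alpha g nabla I J x) := by
  rw [alpha_eq hg hJ hK, alpha_eq hg hK hI, alpha_eq hg hI hJ, omegaDer_alphaTens h hD]
  exact (((hasCovDerivAt_kahler hg hI).wedgeTwo_self.add
    (hasCovDerivAt_kahler hg hJ).wedgeTwo_self).add
      (hasCovDerivAt_kahler hg hK).wedgeTwo_self).covDeriv_eq

end AdaptedBases

end AQH

end

/-! ### Assembly of the main theorem -/

open AQH in
theorem proposition5p3 (n : ℕ) (hn : 2 ≤ n)
    -- a model quaternion-Hermitian vector space of real dimension `4n`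
    {V : Type*} [AddCommGroup V] [Module ℝ V] (hV : Module.finrank ℝ V = 4 * n)
    (g₀ : V →ₗ[ℝ] V →ₗ[ℝ] ℝ) (I₀ J₀ K₀ : V →ₗ[ℝ] V)
    (hmodel : IsQuaternionHermitian g₀ I₀ J₀ K₀) :
    -- universal linear maps between tensor spaces of the model
    ∃ (L_H : Tens V 3 →ₗ[ℝ] Tens V 5) (M_H : Tens V 5 →ₗ[ℝ] Tens V 3)
      (L_S : Tens V 3 × Tens V 3 →ₗ[ℝ] Tens V 5) (M_S : Tens V 5 →ₗ[ℝ] Tens V 3 × Tens V 3),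
      ∀ (M : Type*) [TopologicalSpace M] [ChartedSpace (EuclideanSpace ℝ (Fin (4 * n))) M]
        [IsManifold (𝓡 (4 * n)) ∞ M]
        (g : Bundle.ContMDiffRiemannianMetric (𝓡 (4 * n)) ∞ (EuclideanSpace ℝ (Fin (4 * n)))
          (fun x : M => TangentSpace (𝓡 (4 * n)) x))
        (G : ∀ x : M, Submodule ℝ
          (TangentSpace (𝓡 (4 * n)) x →L[ℝ] TangentSpace (𝓡 (4 * n)) x))
        (nabla : CovariantDerivative (𝓡 (4 * n)) (EuclideanSpace ℝ (Fin (4 * n)))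
          (fun x : M => TangentSpace (𝓡 (4 * n)) x))
        (U : Set M) (I J K : EndField (𝓡 (4 * n)) M),
        IsAlmostQuaternionHermitian g G → IsLeviCivita g nabla → IsOpen U →
        IsAdaptedBasisOn g G U I J K →
        ∀ x ∈ U,
          -- an arbitrary identification of `(T_x M, g, I, J, K)` with the model
          ∀ f : V ≃ₗ[ℝ] TangentSpace (𝓡 (4 * n)) x,
          (∀ X Y, metricAt g x (f X) (f Y) = g₀ X Y) →
          (∀ X, f (I₀ X) = I x (f X)) → (∀ X, f (J₀ X) = J x (f X)) →
          (∀ X, f (K₀ X) = K x (f X)) →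
          -- the `H`-part
          (pullTens f.toLinearMap (nablaOmegaPart g nabla 1 I J K x) =
              L_H (pullTens f.toLinearMap (twistedAlpha g nabla I J K x
                + twistedAlpha g nabla J K I x + twistedAlpha g nabla K I J x)) ∧
            pullTens f.toLinearMap (twistedAlpha g nabla I J K x
                + twistedAlpha g nabla J K I x + twistedAlpha g nabla K I J x) =
              M_H (pullTens f.toLinearMap (nablaOmegaPart g nabla 1 I J K x))) ∧
          -- the `S³H`-part
          (pullTens f.toLinearMap (nablaOmegaPart g nabla 3 I J K x) =
              L_S (pullTens f.toLinearMap
                  (twistedAlpha g nabla I J K x - twistedAlpha g nabla J K I x),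
                pullTens f.toLinearMap
                  (twistedAlpha g nabla J K I x - twistedAlpha g nabla K I J x)) ∧
            (pullTens f.toLinearMap
                  (twistedAlpha g nabla I J K x - twistedAlpha g nabla J K I x),
                pullTens f.toLinearMap
                  (twistedAlpha g nabla J K I x - twistedAlpha g nabla K I J x)) =
              M_S (pullTens f.toLinearMap (nablaOmegaPart g nabla 3 I J K x))) := by
  obtain ⟨L_H, M_H, L_S, M_S, hLM⟩ := exists_partMaps (by omega) hV hmodel
  refine ⟨L_H, M_H, L_S, M_S, ?_⟩
  intro M _ _ _ g G nabla U I J K _ hg hU h x hx f hfg hfI hfJ hfK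
  obtain ⟨DI, DJ, DK, hI, hJ, hK, hD⟩ := h.exists_variation hg hU hx
  have hq := h.hermitian x hx
  have hE : Module.finrank ℝ (EuclideanSpace ℝ (Fin (4 * n))) = 4 * n := finrank_euclideanSpace_fin
  have hn' : 0 < Module.finrank ℝ (EuclideanSpace ℝ (Fin (4 * n))) := by omega
  -- Tangent spaces unfold to the model Euclidean space, so `rfl` identifies their dimension with
  -- the normalizing constant of `λ`; this is what makes the traces cancel.
  have ha := alphaTens_mem hq hD hn' rfl
  have hb := alphaTens_mem hq.cycle hD.cycle hn' rfl
  have hc := alphaTens_mem hq.cycle.cycle hD.cycle.cycle hn' rfl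
  rw [← alpha_eq hg hJ hK] at ha
  rw [← alpha_eq hg hK hI] at hb
  rw [← alpha_eq hg hI hJ] at hc
  unfold nablaOmegaPart twistedAlpha
  rw [nablaOmega_eq hg hI hJ hK hq hD]
  -- The memberships of `α_J` and `α_K` were obtained for the rotated pairs `(J, K)` and `(K, I)`
  -- and are rotated back to `(I, J)`.
  exact hLM _ _ _ _ _ hq _ ha _ (symmInvTens_cycle hq.cycle.cycle (symmInvTens_cycle hq.cycle hb)) _
    (symmInvTens_cycle hq.cycle.cycle hc) f hfg hfI hfJ hfK
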